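/- Let $(R,\mathfrak m)$ be a Noetherian local ring of Krull dimension $d$, and let $I_1,\dots,I_r,J_1,\dots,J_r$ be ideals of $R$ such that $I_i\subseteq J_i$ and the length $\ell_R(J_i/I_i)$ is finite for every $i=1,\dots,r$. Then there exists a polynomial $F\in\mathbb{Q}[x_1,\dots,x_r]$ of total degree at most $d$ with $F(\mathbb{Z}^r)\subseteq\mathbb{Z}$ (a numerical polynomial), and there exists $N\in\mathbb{N}$, such that for all $(n_1,\dots,n_r)\in\mathbb{N}^r$ with $n_i\ge N$ for every $i$, the $R$-module $J_1^{n_1}\cdots J_r^{n_r}/I_1^{n_1}\cdots I_r^{n_r}$ has finite length and $$\ell_R\!\left(\frac{J_1^{n_1}\cdots J_r^{n_r}}{I_1^{n_1}\cdots I_r^{n_r}}\right)=F(n_1,\dots,n_r).$$ -/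

import Mathlib

/-- The ideal `I₁ ^ n₁ ⋯ I_r ^ n_r` attached to a family of ideals and a multi-index. -/
def multiPower {R : Type*} [CommRing R] {r : ℕ} (I : Fin r → Ideal R) (n : Fin r → ℕ) :
    Ideal R :=
  ∏ i, I i ^ n i

/-- The length (possibly infinite) of the `R`-module `J / (I ∩ J)`; this is the length of `J / I`
when `I ≤ J`. -/
noncomputable def quotLength {R : Type*} [CommRing R] (J I : Ideal R) : ℕ∞ :=
  Module.length R (J ⧸ Submodule.submoduleOf I J)

/-- A polynomial with rational coefficients is numerical if it is integer-valued at all integer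
points. -/
def IsNumericalPolynomial {r : ℕ} (F : MvPolynomial (Fin r) ℚ) : Prop :=
  ∀ n : Fin r → ℤ, ∃ m : ℤ, MvPolynomial.eval (fun i => (n i : ℚ)) F = (m : ℚ)

/-! ### Lengths of quotients of nested ideals. -/

section QuotLength

variable {R : Type*} [CommRing R]

/-! Polynomiality and the degree bound have separate proofs.

Polynomiality. Replacing `J j` by `I j` one index at a time (`hybridPower`), and then filtering A^n
P ⊇ B A^(n-1) P ⊇ ... ⊇ B^n P, splits the length into lengths of quotients CA/CB, where C runs over
products of powers of finitely many ideals. Their sum is a Hilbert function, for a coarsened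
grading, of a subquotient of a Noetherian multigraded Rees algebra with components of finite length.
Multiplication by a degree-one generator f on such a subquotient has kernel and cokernel killed by
f. Induction on the number of generators not yet known to act as zero therefore makes all first
differences eventually polynomial, and summation recovers the function
(`eventuallyPolynomial_hilbertFunction`). Integer values at large points force integer values
everywhere, as one sees on diagonal lines.

Degree. On a ray n = ta the length is that of (J^a)^t / (I^a)^t, so only one pair I ⊆ J of ideals
matters. At t = m + 1 it is at most ℓ(J/I) times the sum over s ≤ m of the numbers of generators of
I^s J^(m-s). By Nakayama these numbers are dimensions of components of the special fibre of the Rees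
algebra of two ideals. For d > 0 this fibre has dimension at most d + 1
(`ringKrullDim_multiRees_quotient_le`), so by Noether normalization the lengths summed up to M are
O((M+1)^(d+1)) and the polynomial on the ray has degree at most d. For d = 0 the ring is Artinian
and the lengths are bounded. Positive integer rays detect the total degree, since the coefficient of
t^k on the ray through a is F_k(a), with F_k the homogeneous component. -/

theorem quotLength_eq_length_of_surjective {A B : Ideal R} {M : Type*} [AddCommGroup M] [Module R M]
    (φ : A →ₗ[R] M) (hφ : Function.Surjective φ) (hker : LinearMap.ker φ = B.submoduleOf A) :
    quotLength A B = Module.length R M := by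
  unfold quotLength
  rw [← hker]
  exact (φ.quotKerEquivOfSurjective hφ).length_eq

theorem quotLength_add {A B C : Ideal R} (hBC : B ≤ C) (hCA : C ≤ A) :
    quotLength A B = quotLength A C + quotLength C B := by
  rw [add_comm]
  refine Module.length_eq_add_of_exact
    (Submodule.mapQ (B.submoduleOf C) (B.submoduleOf A) (Submodule.inclusion hCA) ?_)
    (Submodule.mapQ (B.submoduleOf A) (C.submoduleOf A) LinearMap.id ?_) ?_ ?_ ?_
  · intro x hx
    simpa [Submodule.submoduleOf] using hx
  · intro x hx
    have h : x.1 ∈ C := hBC hx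
    simpa [Submodule.submoduleOf] using h
  · rw [← LinearMap.ker_eq_bot, LinearMap.ker_eq_bot']
    intro x
    induction x using Submodule.Quotient.induction_on with
    | H x =>
      intro hx
      rw [Submodule.mapQ_apply, Submodule.Quotient.mk_eq_zero] at hx
      rw [Submodule.Quotient.mk_eq_zero]
      exact hx
  · intro x
    induction x using Submodule.Quotient.induction_on with
    | H x => exact ⟨Submodule.Quotient.mk x, rfl⟩
  · intro x
    induction x using Submodule.Quotient.induction_on with
    | H x =>
      rw [Submodule.mapQ_apply, Submodule.Quotient.mk_eq_zero]
      constructor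
      · intro hx
        exact ⟨Submodule.Quotient.mk ⟨x.1, hx⟩, rfl⟩
      · rintro ⟨y, hy⟩
        induction y using Submodule.Quotient.induction_on with
        | H y =>
          rw [Submodule.mapQ_apply, Submodule.Quotient.eq] at hy
          have h1 : (y.1 - x.1) ∈ B := hy
          have := C.sub_mem y.2 (hBC h1)
          simpa [Submodule.submoduleOf] using this

theorem quotLength_self (A : Ideal R) : quotLength A A = 0 := by
  unfold quotLength
  rw [Submodule.submoduleOf_self, Module.length_eq_zero_iff]
  exact Submodule.Quotient.subsingleton_iff.2 rfl

theorem quotLength_eq_zero_of_le {A B : Ideal R} (h : A ≤ B) : quotLength A B = 0 := by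
  unfold quotLength
  rw [Submodule.submoduleOf_eq_top.2 h, Module.length_eq_zero_iff]
  exact Submodule.Quotient.subsingleton_iff.2 rfl

theorem quotLength_le_length (A B : Ideal R) : quotLength A B ≤ Module.length R R :=
  (Module.length_le_of_surjective _ (Submodule.mkQ_surjective _)).trans
    (Module.length_le_of_injective A.subtype A.subtype_injective)

/-- The colon ideal inside `A` of the elements that `f` multiplies into `B`. -/
def Ideal.mulComap (f : R) (A B : Ideal R) : Ideal R :=
  A ⊓ Submodule.comap (LinearMap.mulLeft R f) B

/-- Multiplication by f maps A onto (fA + B)/B, and its kernel is the colon ideal. This matches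
coimage and image lengths in `hilbertFunction_imageFamily`. -/
theorem quotLength_mulComap (f : R) (A B : Ideal R) :
    quotLength A (Ideal.mulComap f A B) = quotLength (Ideal.span {f} * A ⊔ B) B := by
  have hf : ∀ x ∈ A, f * x ∈ Ideal.span {f} * A ⊔ B := fun x hx =>
    Ideal.mem_sup_left (Ideal.mul_mem_mul (Ideal.mem_span_singleton_self f) hx)
  refine quotLength_eq_length_of_surjective
    ((B.submoduleOf (Ideal.span {f} * A ⊔ B)).mkQ ∘ₗ
      ((LinearMap.mulLeft R f).restrict hf)) ?_ ?_
  · intro y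
    induction y using Submodule.Quotient.induction_on with
    | H y =>
      obtain ⟨y, hy⟩ := y
      obtain ⟨u, hu, b, hb, rfl⟩ := Submodule.mem_sup.1 hy
      obtain ⟨x, hx, rfl⟩ := Ideal.mem_span_singleton_mul.1 hu
      refine ⟨⟨x, hx⟩, ?_⟩
      rw [LinearMap.comp_apply, Submodule.mkQ_apply, Submodule.Quotient.eq]
      have : f * x - (f * x + b) ∈ B := by simpa using hb
      exact this
  · ext x
    rw [LinearMap.mem_ker, LinearMap.comp_apply, Submodule.mkQ_apply,
      Submodule.Quotient.mk_eq_zero]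
    exact ⟨fun h => ⟨x.2, h⟩, fun h => h.2⟩

/-- The generators of c, acting by multiplication, give a surjection from a direct sum of `s.card`
copies of J/I onto cJ/cI. -/
theorem quotLength_mul_le (s : Finset R) {I J : Ideal R} :
    quotLength (Ideal.span (s : Set R) * J) (Ideal.span (s : Set R) * I) ≤
      s.card * quotLength J I := by
  classical
  set c := Ideal.span (s : Set R) with hc
  have hmul : ∀ (x : s) y, y ∈ J → LinearMap.mulLeft R x.1 y ∈ c * J := fun x y hy =>
    Ideal.mul_mem_mul (Ideal.subset_span x.2) hy
  let ψ : s → ((J ⧸ I.submoduleOf J) →ₗ[R] ((c * J : Ideal R) ⧸ (c * I).submoduleOf (c * J))) :=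
    fun x => Submodule.mapQ _ _ ((LinearMap.mulLeft R x.1).restrict (hmul x)) (by
      intro y hy
      have h : x.1 * y.1 ∈ c * I := Ideal.mul_mem_mul (Ideal.subset_span x.2) hy
      exact h)
  let φ := LinearMap.lsum R (fun _ : s => J ⧸ I.submoduleOf J) R ψ
  have hφ_apply : ∀ v, φ v = ∑ x, ψ x (v x) := fun v => by simp [φ, LinearMap.lsum_apply]
  have hφ : Function.Surjective φ := by
    rw [← LinearMap.range_eq_top, eq_top_iff]
    rintro y -
    induction y using Submodule.Quotient.induction_on with
    | H y =>
      obtain ⟨y, hy⟩ := y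
      suffices ∀ y (hy : y ∈ c * J), (Submodule.Quotient.mk ⟨y, hy⟩ :
          (c * J : Ideal R) ⧸ (c * I).submoduleOf (c * J)) ∈ LinearMap.range φ from this y hy
      intro y hy
      induction hy using Submodule.mul_induction_on' with
      | mem_mul_mem m hm n hn =>
        obtain ⟨g, -, hg⟩ := (Submodule.mem_span_finset (R := R)).1 hm
        refine ⟨fun x => g x • Submodule.Quotient.mk ⟨n, hn⟩, ?_⟩
        rw [hφ_apply]
        have : ∀ x : s, ψ x (g x • (Submodule.Quotient.mk ⟨n, hn⟩ : J ⧸ I.submoduleOf J)) =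
            (Submodule.mkQ _) (g x • ⟨x.1 * n, hmul x n hn⟩) := by
          intro x
          rw [map_smul, map_smul]
          rfl
        rw [Finset.sum_congr rfl fun x _ => this x, ← map_sum, Submodule.mkQ_apply]
        congr 1
        apply Subtype.ext
        rw [AddSubmonoidClass.coe_finsetSum]
        change _ = m * n
        rw [← hg, Finset.sum_mul, ← Finset.sum_coe_sort s (fun x => g x • x * n)]
        refine Finset.sum_congr rfl fun x _ => ?_
        change g x * (x.1 * n) = g x * x.1 * n
        rw [mul_assoc]
      | add x hx y hy ihx ihy => exact Submodule.add_mem _ ihx ihy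
  refine (Module.length_le_of_surjective φ hφ).trans ?_
  rw [Module.length_pi]
  simp [quotLength]

theorem quotLength_mul_lt_top [IsNoetherianRing R] (c : Ideal R) {I J : Ideal R}
    (h : quotLength J I < ⊤) : quotLength (c * J) (c * I) < ⊤ := by
  obtain ⟨s, rfl⟩ := IsNoetherian.noetherian c
  exact (quotLength_mul_le s).trans_lt (WithTop.mul_lt_top (ENat.natCast_lt_top _) h)

end QuotLength

/-! ### Eventually polynomial functions, discrete integration and integrality. -/

section EventuallyPolynomial

/-- `h` agrees with a polynomial at all points with all coordinates at least some `N`. -/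
def EventuallyPolynomial {r : ℕ} (h : (Fin r → ℕ) → ℚ) : Prop :=
  ∃ F : MvPolynomial (Fin r) ℚ, ∃ N : ℕ, ∀ n : Fin r → ℕ, (∀ i, N ≤ n i) →
    MvPolynomial.eval (fun i => (n i : ℚ)) F = h n

variable {r : ℕ}

theorem MvPolynomial.eval_aeval_eq {σ τ S : Type*} [CommSemiring S] (x : τ → S)
    (g : σ → MvPolynomial τ S) (F : MvPolynomial σ S) :
    eval x (aeval g F) = eval (fun i => eval x (g i)) F := by
  induction F using MvPolynomial.induction_on with
  | C a => simp [MvPolynomial.algebraMap_eq]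
  | add p q hp hq => rw [map_add, map_add, map_add, hp, hq]
  | mul_X p i hp => rw [map_mul, map_mul, map_mul, hp, aeval_X, eval_X]

namespace EventuallyPolynomial

theorem zero : EventuallyPolynomial (fun _ : Fin r → ℕ => 0) := ⟨0, 0, by simp⟩

theorem add {g h : (Fin r → ℕ) → ℚ} (hg : EventuallyPolynomial g) (hh : EventuallyPolynomial h) :
    EventuallyPolynomial (fun n => g n + h n) := by
  obtain ⟨F, N, hF⟩ := hg
  obtain ⟨G, M, hG⟩ := hh
  refine ⟨F + G, max N M, fun n hn => ?_⟩
  rw [map_add, hF n fun i => (le_max_left _ _).trans (hn i),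
    hG n fun i => (le_max_right _ _).trans (hn i)]

theorem sub {g h : (Fin r → ℕ) → ℚ} (hg : EventuallyPolynomial g) (hh : EventuallyPolynomial h) :
    EventuallyPolynomial (fun n => g n - h n) := by
  obtain ⟨F, N, hF⟩ := hg
  obtain ⟨G, M, hG⟩ := hh
  refine ⟨F - G, max N M, fun n hn => ?_⟩
  rw [map_sub, hF n fun i => (le_max_left _ _).trans (hn i),
    hG n fun i => (le_max_right _ _).trans (hn i)]

theorem sum {ι : Type*} (s : Finset ι) {g : ι → (Fin r → ℕ) → ℚ}
    (hg : ∀ i, EventuallyPolynomial (g i)) : EventuallyPolynomial (fun n => ∑ i ∈ s, g i n) := by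
  classical
  induction s using Finset.induction_on with
  | empty => simpa using zero
  | insert a s ha ih => simpa [Finset.sum_insert ha] using (hg a).add ih

theorem congr {g h : (Fin r → ℕ) → ℚ} (hg : EventuallyPolynomial g) (N : ℕ)
    (hgh : ∀ n : Fin r → ℕ, (∀ i, N ≤ n i) → g n = h n) : EventuallyPolynomial h := by
  obtain ⟨F, M, hF⟩ := hg
  refine ⟨F, max N M, fun n hn => ?_⟩
  rw [hF n fun i => (le_max_right _ _).trans (hn i),
    hgh n fun i => (le_max_left _ _).trans (hn i)]

theorem of_shift {h : (Fin r → ℕ) → ℚ} (v : Fin r → ℕ)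
    (hh : EventuallyPolynomial (fun n => h (n + v))) : EventuallyPolynomial h := by
  obtain ⟨F, N, hF⟩ := hh
  -- The sum of all `v i` dominates each of them, so beyond this threshold the truncated subtraction
  -- `n i - v i` is exact.
  refine ⟨MvPolynomial.aeval (fun i => MvPolynomial.X i - MvPolynomial.C (v i : ℚ)) F,
    N + ∑ i, v i, fun n hn => ?_⟩
  have hv : ∀ i, v i ≤ ∑ i, v i := fun i =>
    Finset.single_le_sum (f := v) (fun _ _ => Nat.zero_le _) (Finset.mem_univ i)
  have hn' : ∀ i, N + v i ≤ n i := fun i => (Nat.add_le_add_left (hv i) N).trans (hn i)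
  have key := hF (fun i => n i - v i) fun i => by have := hn' i; omega
  have e : (fun i => n i - v i) + v = n := by
    funext i
    have := hn' i
    simp only [Pi.add_apply]
    omega
  simp only [e] at key
  rw [← key, MvPolynomial.eval_aeval_eq]
  congr 2
  funext i
  rw [Nat.cast_sub (le_of_add_le_right (hn' i))]
  simp

theorem shift {h : (Fin r → ℕ) → ℚ} (v : Fin r → ℕ)
    (hh : EventuallyPolynomial h) : EventuallyPolynomial (fun n => h (n + v)) := by
  obtain ⟨F, N, hF⟩ := hh
  refine ⟨MvPolynomial.aeval (fun i => MvPolynomial.X i + MvPolynomial.C (v i : ℚ)) F,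
    N, fun n hn => ?_⟩
  rw [MvPolynomial.eval_aeval_eq]
  have := hF (n + v) fun i => (hn i).trans (Nat.le_add_right _ _)
  simpa using this

end EventuallyPolynomial

/-- Faulhaber's formula with Bernoulli numbers. -/
theorem exists_polynomial_sum_range_pow (a : ℕ) :
    ∃ q : Polynomial ℚ, ∀ n : ℕ, q.eval (n : ℚ) = ∑ t ∈ Finset.range n, (t : ℚ) ^ a := by
  refine ⟨∑ i ∈ Finset.range (a + 1),
    Polynomial.C (bernoulli i * ((a + 1).choose i : ℚ) / (a + 1)) * Polynomial.X ^ (a + 1 - i),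
    fun n => ?_⟩
  rw [sum_range_pow, Polynomial.eval_finsetSum]
  refine Finset.sum_congr rfl fun i _ => ?_
  simp only [Polynomial.eval_mul, Polynomial.eval_C, Polynomial.eval_pow, Polynomial.eval_X]
  ring

/-- Discrete integration in the variable i: by linearity it reduces to monomials, where only the
power of that variable is summed. -/
theorem MvPolynomial.exists_sum_range_update (i : Fin r) (F : MvPolynomial (Fin r) ℚ) :
    ∃ G : MvPolynomial (Fin r) ℚ, ∀ n : Fin r → ℕ, eval (fun j => (n j : ℚ)) G =
      ∑ t ∈ Finset.range (n i), eval (fun j => ((Function.update n i t j : ℕ) : ℚ)) F := by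
  induction F using MvPolynomial.induction_on' with
  | monomial s c =>
    obtain ⟨q, hq⟩ := exists_polynomial_sum_range_pow (s i)
    refine ⟨C c * (∏ j ∈ Finset.univ.erase i, X j ^ s j) * Polynomial.aeval (X i) q, fun n => ?_⟩
    have h1 : eval (fun j => (n j : ℚ)) (Polynomial.aeval (X i) q) = q.eval (n i : ℚ) := by
      rw [Polynomial.aeval_def, Polynomial.hom_eval₂, Polynomial.eval, eval_X]
      congr 1
      exact RingHom.ext fun x => by simp [algebraMap_eq]
    have h2 : ∀ m : Fin r → ℕ, eval (fun j => (m j : ℚ)) (monomial s c) =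
        c * (∏ j ∈ Finset.univ.erase i, (m j : ℚ) ^ s j) * (m i : ℚ) ^ s i := by
      intro m
      rw [eval_monomial, Finsupp.prod_fintype _ _ (fun _ => pow_zero _), mul_assoc,
        Finset.prod_erase_mul _ _ (Finset.mem_univ i)]
    rw [map_mul, map_mul, h1, hq, Finset.mul_sum, eval_C, map_prod]
    refine Finset.sum_congr rfl fun t _ => ?_
    rw [h2, Function.update_self]
    congr 2
    refine Finset.prod_congr rfl fun j hj => ?_
    rw [Function.update_of_ne (Finset.ne_of_mem_erase hj)]
    simp
  | add F F' hF hF' =>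
    obtain ⟨G, hG⟩ := hF
    obtain ⟨G', hG'⟩ := hF'
    refine ⟨G + G', fun n => ?_⟩
    simp only [map_add, hG, hG', Finset.sum_add_distrib]

/-- A function all of whose first differences are eventually polynomial is eventually
polynomial. -/
theorem EventuallyPolynomial.of_forall_difference {h : (Fin r → ℕ) → ℚ}
    (hh : ∀ i, EventuallyPolynomial (fun n => h (n + Pi.single i 1) - h n)) :
    EventuallyPolynomial h := by
  classical
  choose P N hP using hh
  set M := ∑ i, N i with hM
  have hNM : ∀ i, N i ≤ M := fun i =>
    Finset.single_le_sum (f := N) (fun _ _ => Nat.zero_le _) (Finset.mem_univ i)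
  set v : Fin r → ℕ := fun _ => M with hv
  -- After translation by the common threshold M the differences are polynomial on all of ℕ^r, so
  -- summation can start at the origin.
  refine of_shift v ?_
  choose G hG using fun i => MvPolynomial.exists_sum_range_update i
    (MvPolynomial.aeval (fun j => MvPolynomial.X j + MvPolynomial.C (v j : ℚ)) (P i))
  have hstep : ∀ i (n : Fin r → ℕ), h (n + Pi.single i 1 + v) - h (n + v) =
      MvPolynomial.eval (fun j => (n j : ℚ))
        (MvPolynomial.aeval (fun j => MvPolynomial.X j + MvPolynomial.C (v j : ℚ)) (P i)) := by
    intro i n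
    rw [MvPolynomial.eval_aeval_eq, add_right_comm]
    have := hP i (n + v) fun j => (hNM i).trans (Nat.le_add_left _ _)
    simpa using this.symm
  have hG' : ∀ i (n : Fin r → ℕ), MvPolynomial.eval (fun j => (n j : ℚ)) (G i) =
      h (n + v) - h (Function.update n i 0 + v) := by
    intro i n
    rw [hG, ← Function.update_eq_self i n]
    generalize n i = m
    simp only [Function.update_self, Function.update_idem]
    induction m with
    | zero => simp
    | succ m ih =>
      rw [Finset.sum_range_succ, ih, ← hstep]
      have : Function.update n i m + Pi.single i 1 = Function.update n i (m + 1) := by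
        funext j
        by_cases hj : j = i
        · subst hj; simp
        · simp [hj]
      rw [this]
      ring
  -- The coordinates outside S are frozen at 0. Adding i to S adds the increment along coordinate i,
  -- which is given by the discrete integral `G i`.
  have key : ∀ S : Finset (Fin r), ∃ F : MvPolynomial (Fin r) ℚ, ∀ n : Fin r → ℕ,
      MvPolynomial.eval (fun j => (n j : ℚ)) F = h ((fun j => if j ∈ S then n j else 0) + v) := by
    intro S
    induction S using Finset.induction_on with
    | empty => exact ⟨MvPolynomial.C (h ((fun _ => 0) + v)), fun n => by simp⟩
    | insert i S hi ih =>
      obtain ⟨F, hF⟩ := ih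
      refine ⟨F + MvPolynomial.aeval
        (fun j => if j ∈ insert i S then MvPolynomial.X j else 0) (G i), fun n => ?_⟩
      have e1 : (fun j => MvPolynomial.eval (fun j => (n j : ℚ))
          (if j ∈ insert i S then MvPolynomial.X j else 0)) =
          fun j => ((if j ∈ insert i S then n j else 0 : ℕ) : ℚ) := by
        funext j
        split_ifs <;> simp
      have e2 : Function.update (fun j => if j ∈ insert i S then n j else 0) i 0 =
          fun j => if j ∈ S then n j else 0 := by
        funext j
        by_cases hj : j = i
        · subst hj; simp [hi]
        · simp [hj]
      rw [map_add, MvPolynomial.eval_aeval_eq, hF, e1, hG', e2]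
      ring
  obtain ⟨F, hF⟩ := key Finset.univ
  exact ⟨F, 0, fun n _ => by simpa using hF n⟩

/-- A rational polynomial with integer values at all large integers has integer values at all
integers. -/
theorem Polynomial.exists_int_eval_of_eventually (p : Polynomial ℚ) (T : ℤ)
    (hp : ∀ t : ℤ, T ≤ t → ∃ m : ℤ, p.eval (t : ℚ) = m) (t : ℤ) : ∃ m : ℤ, p.eval (t : ℚ) = m := by
  induction hd : p.natDegree using Nat.strong_induction_on generalizing p T t with
  | _ D ih =>
  by_cases hD : D = 0
  · obtain ⟨m, hm⟩ := hp T le_rfl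
    rw [Polynomial.eq_C_of_natDegree_eq_zero (hd.trans hD), Polynomial.eval_C] at hm ⊢
    exact ⟨m, hm⟩
  -- The difference polynomial has smaller degree, so it is integer-valued by induction. Then p(t) =
  -- p(t+1) - q(t) carries integrality downwards from T.
  set q := p.comp (X + C 1) - p with hq
  have hqe : ∀ t : ℤ, q.eval (t : ℚ) = p.eval ((t + 1 : ℤ) : ℚ) - p.eval (t : ℚ) := by
    intro t
    simp [hq]
  have hqd : q.natDegree < D := by
    have hp0 : p ≠ 0 := by
      rintro rfl
      exact hD (by simpa using hd.symm)
    have h1 : (p.comp (X + C 1)).degree = p.degree := by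
      rw [Polynomial.degree_eq_natDegree hp0, Polynomial.degree_eq_natDegree, natDegree_comp,
        natDegree_X_add_C, mul_one]
      intro h0
      have := congrArg natDegree h0
      rw [natDegree_comp, natDegree_X_add_C, mul_one, natDegree_zero] at this
      omega
    have h2 : q.degree < p.degree := by
      refine (Polynomial.degree_sub_lt_left h1 ?_ ?_).trans_eq h1
      · intro h0
        rw [h0, degree_zero] at h1
        exact hp0 (degree_eq_bot.1 h1.symm)
      · rw [leadingCoeff_comp (by rw [natDegree_X_add_C]; exact one_ne_zero)]
        rw [leadingCoeff_X_add_C, one_pow, mul_one]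
    by_cases hq0 : q = 0
    · rw [hq0, natDegree_zero]; omega
    · rw [← hd]
      exact natDegree_lt_natDegree hq0 h2
  have hqi : ∀ t : ℤ, ∃ m : ℤ, q.eval (t : ℚ) = m := by
    intro t
    refine ih _ hqd q T ?_ t rfl
    intro t ht
    obtain ⟨a, ha⟩ := hp (t + 1) (by omega)
    obtain ⟨b, hb⟩ := hp t ht
    exact ⟨a - b, by rw [hqe, ha, hb]; push_cast; ring⟩
  have hdown : ∀ k : ℕ, ∃ m : ℤ, p.eval ((T - k : ℤ) : ℚ) = m := by
    intro k
    induction k with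
    | zero => simpa using hp T le_rfl
    | succ k ihk =>
      obtain ⟨a, ha⟩ := ihk
      obtain ⟨b, hb⟩ := hqi (T - (k + 1 : ℕ))
      refine ⟨a - b, ?_⟩
      rw [hqe] at hb
      have : (T - (k + 1 : ℕ) + 1 : ℤ) = T - k := by push_cast; ring
      rw [this, ha] at hb
      push_cast at hb ⊢
      linarith
  by_cases ht : T ≤ t
  · exact hp t ht
  · have := hdown (T - t).toNat
    rwa [show T - ((T - t).toNat : ℤ) = t by omega] at this

/-- The restriction of a polynomial to the line `t ↦ u + t • v`. -/
theorem MvPolynomial.eval_lineMap {σ : Type*} (F : MvPolynomial σ ℚ) (u v : σ → ℚ) (t : ℚ) :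
    (aeval (fun i => Polynomial.C (u i) + Polynomial.C (v i) * Polynomial.X) F).eval t =
      eval (fun i => u i + v i * t) F := by
  induction F using MvPolynomial.induction_on with
  | C a => simp
  | add p q hp hq => simp [hp, hq]
  | mul_X p i hp => simp [hp]

/-- On the line n + t(1, ..., 1) all coordinates are at least N once t ≥ N + Σ|n i|. The
one-variable result along this line is then read at t = 0. -/
theorem isNumericalPolynomial_of_eventually {F : MvPolynomial (Fin r) ℚ} {N : ℕ}
    (hF : ∀ n : Fin r → ℕ, (∀ i, N ≤ n i) →
      ∃ m : ℤ, MvPolynomial.eval (fun i => (n i : ℚ)) F = m) : IsNumericalPolynomial F := by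
  intro n
  set p : Polynomial ℚ :=
    MvPolynomial.aeval (fun i => Polynomial.C (n i : ℚ) + Polynomial.C 1 * Polynomial.X) F with hp
  have hpe : ∀ t : ℤ, p.eval (t : ℚ) = MvPolynomial.eval (fun i => ((n i + t : ℤ) : ℚ)) F := by
    intro t
    rw [hp, MvPolynomial.eval_lineMap]
    simp
  have key := p.exists_int_eval_of_eventually (N + ∑ i, |n i|) (fun t ht => ?_) 0
  · rw [hpe] at key
    simpa using key
  · have hn : ∀ i, |n i| ≤ ∑ i, |n i| := fun i =>
      Finset.single_le_sum (f := fun i => |n i|) (fun _ _ => abs_nonneg _) (Finset.mem_univ i)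
    have hnt : ∀ i, (N : ℤ) ≤ n i + t := fun i => by
      have h1 := hn i
      have h2 := neg_abs_le (n i)
      linarith
    obtain ⟨m, hm⟩ := hF (fun i => (n i + t).toNat) fun i => by
      have := hnt i
      omega
    refine ⟨m, ?_⟩
    rw [hpe, ← hm]
    congr 2
    funext i
    have := hnt i
    rw [← Int.cast_natCast, Int.toNat_of_nonneg (by omega)]

end EventuallyPolynomial

/-! ### Multigraded Rees algebras and an Artin–Rees statement. -/

section MultiRees

open Finsupp MvPolynomial

variable {R : Type*} [CommRing R] {κ : Type*} [Fintype κ]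

/-- The product of powers `∏ K_k ^ a_k`. -/
def idealPow (K : κ → Ideal R) (a : κ →₀ ℕ) : Ideal R := ∏ k, K k ^ a k

theorem idealPow_zero (K : κ → Ideal R) : idealPow K 0 = ⊤ := by
  simp [idealPow]

theorem idealPow_add (K : κ → Ideal R) (a b : κ →₀ ℕ) :
    idealPow K (a + b) = idealPow K a * idealPow K b := by
  simp [idealPow, pow_add, Finset.prod_mul_distrib]

theorem idealPow_single (K : κ → Ideal R) (k : κ) : idealPow K (single k 1) = K k := by
  classical
  rw [idealPow, Finset.prod_eq_single k (fun b _ hb => by rw [single_eq_of_ne hb, pow_zero])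
    (fun h => (h (Finset.mem_univ k)).elim), single_eq_same, pow_one]

/-- A family of ideals bounded by a multiplicative family on the unit vectors is bounded by it
everywhere. -/
theorem idealPow_le_of_single_le {K : κ → Ideal R} {M : (κ →₀ ℕ) → Ideal R} (h0 : M 0 = ⊤)
    (hmul : ∀ a b, M a * M b ≤ M (a + b)) (h1 : ∀ k, K k ≤ M (single k 1)) (a : κ →₀ ℕ) :
    idealPow K a ≤ M a := by
  induction a using Finsupp.induction_linear with
  | zero => rw [h0]; exact le_top
  | add a b ha hb => rw [idealPow_add]; exact (Ideal.mul_mono ha hb).trans (hmul a b)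
  | single k n =>
    induction n with
    | zero => rw [single_zero, h0]; exact le_top
    | succ n ih =>
      rw [single_add, idealPow_add, idealPow_single]
      exact (Ideal.mul_mono ih (h1 k)).trans (hmul _ _)

/-- The Rees algebra of a finite family of ideals, as a subalgebra of the polynomial ring. -/
def multiRees (K : κ → Ideal R) : Subalgebra R (MvPolynomial κ R) where
  carrier := {f | ∀ a, coeff a f ∈ idealPow K a}
  mul_mem' := by
    classical
    intro f g hf hg a
    rw [coeff_mul]
    refine Ideal.sum_mem _ fun x hx => ?_
    rw [← Finset.HasAntidiagonal.mem_antidiagonal.1 hx, idealPow_add]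
    exact Ideal.mul_mem_mul (hf _) (hg _)
  add_mem' := by
    intro f g hf hg a
    rw [coeff_add]
    exact Ideal.add_mem _ (hf a) (hg a)
  algebraMap_mem' := by
    classical
    intro x a
    rw [algebraMap_eq, coeff_C]
    split_ifs with h
    · rw [← h, idealPow_zero]; trivial
    · exact Ideal.zero_mem _

theorem monomial_mem_multiRees {K : κ → Ideal R} {a : κ →₀ ℕ} {c : R} (hc : c ∈ idealPow K a) :
    monomial a c ∈ multiRees K := by
  classical
  intro b
  rw [coeff_monomial]
  split_ifs with h
  · rwa [← h]
  · exact Ideal.zero_mem _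

theorem adjoin_monomial_eq_multiRees {K : κ → Ideal R} {s : κ → Set R}
    (hs : ∀ k, Ideal.span (s k) = K k) :
    Algebra.adjoin R (⋃ k, monomial (single k 1) '' s k) = multiRees K := by
  apply le_antisymm
  · refine Algebra.adjoin_le (Set.iUnion_subset fun k => ?_)
    rintro _ ⟨c, hc, rfl⟩
    refine monomial_mem_multiRees ?_
    rw [idealPow_single, ← hs]
    exact Ideal.subset_span hc
  · intro f hf
    set B := Algebra.adjoin R (⋃ k, (monomial (single k 1) : R →ₗ[R] MvPolynomial κ R) '' s k)
    have key : ∀ a, idealPow K a ≤ Submodule.comap (monomial a) (Subalgebra.toSubmodule B) := by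
      refine idealPow_le_of_single_le ?_ ?_ ?_
      · rw [Ideal.eq_top_iff_one]
        exact B.one_mem
      · intro a b
        rw [Ideal.mul_le]
        intro x hx y hy
        have : monomial (a + b) (x * y) ∈ B := by
          rw [← monomial_mul]
          exact B.mul_mem hx hy
        exact this
      · intro k
        rw [← hs, Ideal.span_le]
        intro c hc
        exact Algebra.subset_adjoin (Set.mem_iUnion.2 ⟨k, c, hc, rfl⟩)
    rw [f.as_sum]
    exact B.sum_mem fun a _ => key a (hf a)

theorem multiRees_fg [IsNoetherianRing R] (K : κ → Ideal R) : (multiRees K).FG := by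
  classical
  choose s hs using fun k => IsNoetherian.noetherian (K k)
  rw [← adjoin_monomial_eq_multiRees (s := fun k => (s k : Set R)) hs]
  refine ⟨Finset.univ.biUnion fun k => (s k).image (monomial (single k 1)), ?_⟩
  simp

instance [IsNoetherianRing R] (K : κ → Ideal R) : IsNoetherianRing (multiRees K) :=
  isNoetherianRing_of_fg (multiRees_fg K)

/-- A family of ideals inside `idealPow K` that is closed under multiplication by the ideals
`K k`, i.e. a homogeneous ideal of the Rees algebra. -/
structure IsStableFamily (K : κ → Ideal R) (𝔞 : (κ →₀ ℕ) → Ideal R) : Prop where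
  le : ∀ a, 𝔞 a ≤ idealPow K a
  mul_le : ∀ k a, K k * 𝔞 a ≤ 𝔞 (a + single k 1)

theorem IsStableFamily.idealPow_mul_le {K : κ → Ideal R} {𝔞 : (κ →₀ ℕ) → Ideal R}
    (h : IsStableFamily K 𝔞) (b a : κ →₀ ℕ) : idealPow K b * 𝔞 a ≤ 𝔞 (a + b) := by
  induction b using Finsupp.induction_linear generalizing a with
  | zero => rw [add_zero]; exact Ideal.mul_le_right
  | add b c hb hc =>
    rw [idealPow_add, mul_assoc]
    refine (Ideal.mul_mono_right (hc a)).trans ((hb _).trans_eq ?_)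
    rw [add_assoc, add_comm c]
  | single k n =>
    induction n generalizing a with
    | zero => rw [single_zero, add_zero]; exact Ideal.mul_le_right
    | succ n ih =>
      rw [single_add, idealPow_add, idealPow_single, mul_assoc]
      refine (Ideal.mul_mono_right (h.mul_le k a)).trans ((ih _).trans_eq ?_)
      rw [add_assoc, add_comm (single k 1)]

/-- The ideal of the Rees algebra attached to a stable family. -/
def IsStableFamily.toIdeal {K : κ → Ideal R} {𝔞 : (κ →₀ ℕ) → Ideal R}
    (h : IsStableFamily K 𝔞) : Ideal (multiRees K) where
  carrier := {f | ∀ a, coeff a f.1 ∈ 𝔞 a}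
  add_mem' := fun {f g} hf hg a => by
    change coeff a (f.1 + g.1) ∈ 𝔞 a
    rw [coeff_add]
    exact Ideal.add_mem _ (hf a) (hg a)
  zero_mem' := fun a => Ideal.zero_mem _
  smul_mem' := fun f g hg a => by
    classical
    change coeff a (f.1 * g.1) ∈ 𝔞 a
    rw [coeff_mul]
    refine Ideal.sum_mem _ fun x hx => ?_
    rw [← Finset.HasAntidiagonal.mem_antidiagonal.1 hx, add_comm]
    exact h.idealPow_mul_le _ _ (Ideal.mul_mem_mul (f.2 _) (hg _))

/-- **Artin–Rees** for stable families. -/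
theorem IsStableFamily.exists_le_mul [IsNoetherianRing R] {K : κ → Ideal R}
    {𝔞 : (κ →₀ ℕ) → Ideal R} (h : IsStableFamily K 𝔞) :
    ∃ N : ℕ, ∀ k a, N ≤ a k → 𝔞 (a + single k 1) ≤ K k * 𝔞 a := by
  classical
  obtain ⟨s, hs⟩ := IsNoetherian.noetherian h.toIdeal
  -- This bounds every exponent occurring in the finitely many generators. In degree a + e_k with a
  -- k at least this large, each multiplier of a generator must have a positive k-exponent, and a
  -- factor from `K k` splits off.
  refine ⟨∑ f ∈ s, ∑ c ∈ f.1.support, ∑ k, c k, fun k a hk x hx => ?_⟩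
  have hbound : ∀ f ∈ s, ∀ c ∈ f.1.support, c k ≤ a k := by
    intro f hf c hc
    have h1 : c k ≤ ∑ k, c k :=
      Finset.single_le_sum (f := fun k => c k) (fun _ _ => Nat.zero_le _) (Finset.mem_univ k)
    have h2 : ∑ k, c k ≤ ∑ c ∈ f.1.support, ∑ k, c k :=
      Finset.single_le_sum (f := fun c : κ →₀ ℕ => ∑ k, c k) (fun _ _ => Nat.zero_le _) hc
    have h3 : ∑ c ∈ f.1.support, ∑ k, c k ≤ ∑ f ∈ s, ∑ c ∈ f.1.support, ∑ k, c k :=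
      Finset.single_le_sum (f := fun f : multiRees K => ∑ c ∈ f.1.support, ∑ k, c k)
        (fun _ _ => Nat.zero_le _) hf
    exact (h1.trans h2).trans (h3.trans hk)
  have hxm : (⟨monomial (a + single k 1) x, monomial_mem_multiRees (h.le _ hx)⟩ : multiRees K) ∈
      h.toIdeal := by
    intro b
    change coeff b (monomial (a + single k 1) x) ∈ 𝔞 b
    rw [coeff_monomial]
    split_ifs with hb
    · rwa [← hb]
    · exact Ideal.zero_mem _
  rw [← hs] at hxm
  obtain ⟨g, -, hg⟩ := (Submodule.mem_span_finset (R := multiRees K)).1 hxm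
  have hx' : x = ∑ f ∈ s, coeff (a + single k 1) ((g f).1 * f.1) := by
    have := congrArg (fun f : multiRees K => coeff (a + single k 1) f.1) hg
    simp only [AddSubmonoidClass.coe_finsetSum, coeff_sum, coeff_monomial, if_pos] at this
    exact this.symm
  rw [hx']
  refine Ideal.sum_mem _ fun f hf => ?_
  rw [coeff_mul]
  refine Ideal.sum_mem _ fun y hy => ?_
  by_cases hc : y.2 ∈ f.1.support
  · have hyk := hbound f hf _ hc
    have hy' := Finset.HasAntidiagonal.mem_antidiagonal.1 hy
    have hpos : 1 ≤ y.1 k := by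
      have := DFunLike.congr_fun hy' k
      simp only [Finsupp.coe_add, Pi.add_apply, single_eq_same] at this
      omega
    obtain ⟨b, hb⟩ : ∃ b, y.1 = single k 1 + b :=
      le_iff_exists_add.1 (single_le_iff.2 hpos)
    have hab : y.2 + b = a := by
      have : single k 1 + (y.2 + b) = single k 1 + a := by
        rw [add_comm _ a, ← hy', hb]; abel
      exact add_left_cancel this
    have hfm : coeff y.2 f.1 ∈ 𝔞 y.2 := by
      have : f ∈ h.toIdeal := by rw [← hs]; exact Ideal.subset_span hf
      exact this _
    have h1 : coeff y.1 (g f).1 * coeff y.2 f.1 ∈ idealPow K y.1 * 𝔞 y.2 :=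
      Ideal.mul_mem_mul ((g f).2 _) hfm
    rw [hb, idealPow_add, idealPow_single, mul_assoc] at h1
    have h2 := Ideal.mul_mono_right (I := K k) (h.idealPow_mul_le b y.2) h1
    rwa [hab, ← hb] at h2
  · rw [MvPolynomial.notMem_support_iff.1 hc, mul_zero]
    exact Ideal.zero_mem _

end MultiRees

/-! ### Hilbert functions of subquotients of Rees algebras. -/

section HilbertFunction

open Finsupp

theorem quotLength_lt_top_of_le {R : Type*} [CommRing R] {A B C : Ideal R} (h : quotLength A B < ⊤)
    (hBC : B ≤ C) (hCA : C ≤ A) : quotLength A C < ⊤ ∧ quotLength C B < ⊤ := by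
  rw [quotLength_add hBC hCA] at h
  exact ⟨lt_of_le_of_lt le_self_add h, lt_of_le_of_lt le_add_self h⟩

theorem toNat_quotLength_add {R : Type*} [CommRing R] {A B C : Ideal R} (h : quotLength A B < ⊤)
    (hBC : B ≤ C) (hCA : C ≤ A) :
    (quotLength A B).toNat = (quotLength A C).toNat + (quotLength C B).toNat := by
  have h' := quotLength_lt_top_of_le h hBC hCA
  rw [quotLength_add hBC hCA, ENat.toNat_add h'.1.ne h'.2.ne]

variable {κ : Type*}

section KernelImage

variable {R : Type*} [CommRing R] {𝔞 𝔟 : (κ →₀ ℕ) → Ideal R} {k : κ} {f : R}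

/-- The kernel of multiplication by `f` in degree `k` on `𝔞 / 𝔟`. -/
noncomputable def kernelFamily (k : κ) (f : R) (𝔞 𝔟 : (κ →₀ ℕ) → Ideal R) (a : κ →₀ ℕ) : Ideal R :=
  Ideal.mulComap f (𝔞 a) (𝔟 (a + single k 1))

open Classical in
/-- The preimage in `𝔞` of the image of multiplication by `f` in degree `k` on `𝔞 / 𝔟`. -/
noncomputable def imageFamily (k : κ) (f : R) (𝔞 𝔟 : (κ →₀ ℕ) → Ideal R) (a : κ →₀ ℕ) : Ideal R :=
  if 1 ≤ a k then Ideal.span {f} * 𝔞 (a - single k 1) ⊔ 𝔟 a else 𝔟 a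

theorem imageFamily_add_single (a : κ →₀ ℕ) : imageFamily k f 𝔞 𝔟 (a + single k 1) =
    Ideal.span {f} * 𝔞 a ⊔ 𝔟 (a + single k 1) := by
  rw [imageFamily, if_pos (by simp), add_tsub_cancel_right]

theorem imageFamily_of_eq_zero {a : κ →₀ ℕ} (ha : a k = 0) : imageFamily k f 𝔞 𝔟 a = 𝔟 a := by
  rw [imageFamily, if_neg (by omega)]

theorem eq_add_single_of_ne_zero {a : κ →₀ ℕ} (ha : a k ≠ 0) : ∃ b, a = b + single k 1 :=
  ⟨a - single k 1, (tsub_add_cancel_of_le (single_le_iff.2 (Nat.one_le_iff_ne_zero.2 ha))).symm⟩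

theorem le_imageFamily (a : κ →₀ ℕ) : 𝔟 a ≤ imageFamily k f 𝔞 𝔟 a := by
  rw [imageFamily]
  split_ifs
  · exact le_sup_right
  · exact le_rfl

end KernelImage

variable [Fintype κ] {r : ℕ}

theorem mapDomain_apply_eq_sum_ite (π : κ → Fin r) (a : κ →₀ ℕ) (i : Fin r) :
    mapDomain π a i = ∑ k, if π k = i then a k else 0 := by
  classical
  rw [mapDomain, Finsupp.sum_apply, Finsupp.sum_fintype _ _ (by simp)]
  exact Finset.sum_congr rfl fun k _ => by rw [single_apply]

theorem finite_weightFiber (π : κ → Fin r) (n : Fin r → ℕ) :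
    {a : κ →₀ ℕ | ⇑(mapDomain π a) = n}.Finite := by
  classical
  refine (Set.finite_Iic (equivFunOnFinite.symm fun k => n (π k))).subset fun a ha k => ?_
  have h : ⇑(mapDomain π a) = n := ha
  rw [equivFunOnFinite_symm_apply_apply, ← h, mapDomain_apply_eq_sum_ite]
  refine le_trans (le_of_eq ?_) (Finset.single_le_sum
    (f := fun j => if π j = π k then a j else 0) (fun _ _ => Nat.zero_le _) (Finset.mem_univ k))
  simp

/-- The multi-indices of a given weight with respect to `π`. -/
noncomputable def weightFiber (π : κ → Fin r) (n : Fin r → ℕ) : Finset (κ →₀ ℕ) :=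
  (finite_weightFiber π n).toFinset

theorem mem_weightFiber {π : κ → Fin r} {n : Fin r → ℕ} {a : κ →₀ ℕ} :
    a ∈ weightFiber π n ↔ ⇑(mapDomain π a) = n := by
  simp [weightFiber]

theorem add_single_mem_weightFiber {π : κ → Fin r} {n : Fin r → ℕ} {a : κ →₀ ℕ} {k : κ} :
    a + single k 1 ∈ weightFiber π (n + Pi.single (π k) 1) ↔ a ∈ weightFiber π n := by
  classical
  rw [mem_weightFiber, mem_weightFiber, mapDomain_add, mapDomain_single, Finsupp.coe_add,
    single_eq_pi_single, add_left_inj]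

variable {R : Type*} [CommRing R]

/-- The Hilbert function of a subquotient `𝔞 / 𝔟` of a Rees algebra, for the coarsened grading
given by `π`. -/
noncomputable def hilbertFunction (π : κ → Fin r) (𝔞 𝔟 : (κ →₀ ℕ) → Ideal R) (n : Fin r → ℕ) : ℚ :=
  ∑ a ∈ weightFiber π n, ((quotLength (𝔞 a) (𝔟 a)).toNat : ℚ)

theorem hilbertFunction_add (π : κ → Fin r) {𝔞 𝔟 𝔠 : (κ →₀ ℕ) → Ideal R}
    (hfin : ∀ a, quotLength (𝔞 a) (𝔟 a) < ⊤) (h1 : ∀ a, 𝔟 a ≤ 𝔠 a) (h2 : ∀ a, 𝔠 a ≤ 𝔞 a)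
    (n : Fin r → ℕ) :
    hilbertFunction π 𝔞 𝔟 n = hilbertFunction π 𝔞 𝔠 n + hilbertFunction π 𝔠 𝔟 n := by
  rw [hilbertFunction, hilbertFunction, hilbertFunction, ← Finset.sum_add_distrib]
  refine Finset.sum_congr rfl fun a _ => ?_
  rw [toNat_quotLength_add (hfin a) (h1 a) (h2 a), Nat.cast_add]

section Families

variable {K : κ → Ideal R} {𝔞 𝔟 : (κ →₀ ℕ) → Ideal R} {k : κ} {f : R}

theorem imageFamily_le (h𝔞 : IsStableFamily K 𝔞) (hle : ∀ a, 𝔟 a ≤ 𝔞 a) (hf : f ∈ K k)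
    (a : κ →₀ ℕ) : imageFamily k f 𝔞 𝔟 a ≤ 𝔞 a := by
  by_cases ha : a k = 0
  · rw [imageFamily_of_eq_zero ha]
    exact hle a
  · obtain ⟨b, rfl⟩ := eq_add_single_of_ne_zero ha
    rw [imageFamily_add_single]
    refine sup_le ((Ideal.mul_mono_left ?_).trans (h𝔞.mul_le k b)) (hle _)
    rwa [Ideal.span_singleton_le_iff_mem]

theorem IsStableFamily.imageFamily (h𝔞 : IsStableFamily K 𝔞) (h𝔟 : IsStableFamily K 𝔟)
    (hle : ∀ a, 𝔟 a ≤ 𝔞 a) (hf : f ∈ K k) : IsStableFamily K (imageFamily k f 𝔞 𝔟) where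
  le a := (imageFamily_le h𝔞 hle hf a).trans (h𝔞.le a)
  mul_le l a := by
    by_cases ha : a k = 0
    · rw [imageFamily_of_eq_zero ha]
      exact (h𝔟.mul_le l a).trans (le_imageFamily _)
    · obtain ⟨b, rfl⟩ := eq_add_single_of_ne_zero ha
      rw [imageFamily_add_single, add_right_comm, imageFamily_add_single, Ideal.mul_sup]
      refine sup_le_sup ?_ ((h𝔟.mul_le l _).trans_eq (by rw [add_right_comm]))
      rw [mul_left_comm]
      exact Ideal.mul_mono_right (h𝔞.mul_le l b)

theorem IsStableFamily.kernelFamily (h𝔞 : IsStableFamily K 𝔞) (h𝔟 : IsStableFamily K 𝔟) :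
    IsStableFamily K (kernelFamily k f 𝔞 𝔟) where
  le a := inf_le_left.trans (h𝔞.le a)
  mul_le l a := by
    rw [Ideal.mul_le]
    rintro y hy x ⟨hx, hfx⟩
    refine ⟨h𝔞.mul_le l a (Ideal.mul_mem_mul hy hx), ?_⟩
    have h1 := h𝔟.mul_le l _ (Ideal.mul_mem_mul hy hfx)
    rw [add_right_comm] at h1
    change f * (y * x) ∈ 𝔟 (a + single l 1 + single k 1)
    rw [mul_left_comm]
    exact h1

theorem le_kernelFamily (h𝔟 : IsStableFamily K 𝔟) (hle : ∀ a, 𝔟 a ≤ 𝔞 a) (hf : f ∈ K k)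
    (a : κ →₀ ℕ) : 𝔟 a ≤ kernelFamily k f 𝔞 𝔟 a :=
  fun _ hx => ⟨hle a hx, h𝔟.mul_le k a (Ideal.mul_mem_mul hf hx)⟩

/-- Multiplication by f identifies coimage and image with a shift by e_k. Multi-indices with `a k =
0` are not hit, but there the image family equals 𝔟 and contributes 0. -/
theorem hilbertFunction_imageFamily (π : κ → Fin r) (n : Fin r → ℕ) :
    hilbertFunction π (imageFamily k f 𝔞 𝔟) 𝔟 (n + Pi.single (π k) 1) =
      hilbertFunction π 𝔞 (kernelFamily k f 𝔞 𝔟) n := by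
  symm
  refine Finset.sum_of_injOn (fun a => a + single k 1) (add_left_injective _).injOn ?_ ?_ ?_
  · intro a ha
    exact add_single_mem_weightFiber.2 ha
  · intro a ha hna
    have hak : a k = 0 := by
      by_contra hak
      obtain ⟨b, rfl⟩ := eq_add_single_of_ne_zero hak
      exact hna ⟨b, add_single_mem_weightFiber.1 ha, rfl⟩
    rw [imageFamily_of_eq_zero hak, quotLength_self]
    simp
  · intro a _
    rw [imageFamily_add_single, kernelFamily, quotLength_mulComap]

/-- Additivity of length on the exact sequence kernel → M → M shifted → cokernel of multiplication
by f on M = 𝔞/𝔟; the coimage and image terms cancel. -/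
theorem hilbertFunction_difference (π : κ → Fin r) (h𝔞 : IsStableFamily K 𝔞)
    (h𝔟 : IsStableFamily K 𝔟) (hle : ∀ a, 𝔟 a ≤ 𝔞 a) (hfin : ∀ a, quotLength (𝔞 a) (𝔟 a) < ⊤)
    (hf : f ∈ K k) (n : Fin r → ℕ) :
    hilbertFunction π 𝔞 𝔟 (n + Pi.single (π k) 1) - hilbertFunction π 𝔞 𝔟 n =
      hilbertFunction π 𝔞 (imageFamily k f 𝔞 𝔟) (n + Pi.single (π k) 1) -
        hilbertFunction π (kernelFamily k f 𝔞 𝔟) 𝔟 n := by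
  rw [hilbertFunction_add π hfin le_imageFamily (imageFamily_le h𝔞 hle hf),
    hilbertFunction_imageFamily,
    hilbertFunction_add π hfin (le_kernelFamily h𝔟 hle hf) (fun a => inf_le_left) n]
  ring

/-- T holds the generators that may still act nontrivially on 𝔞/𝔟. Passing to the kernel or cokernel
of one of them removes it from T, which drives the induction on the cardinality. -/
theorem eventuallyPolynomial_hilbertFunction_of_forall_notMem [IsNoetherianRing R] (π : κ → Fin r)
    (s : κ → Finset R) (hs : ∀ k, Ideal.span (s k : Set R) = K k) (T : Finset (κ × R))
    (hT : ∀ p ∈ T, p.2 ∈ K p.1) (h𝔞 : IsStableFamily K 𝔞)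
    (h𝔟 : IsStableFamily K 𝔟) (hle : ∀ a, 𝔟 a ≤ 𝔞 a) (hfin : ∀ a, quotLength (𝔞 a) (𝔟 a) < ⊤)
    (hkill : ∀ k, ∀ f ∈ s k, (k, f) ∉ T → ∀ a, ∀ x ∈ 𝔞 a, f * x ∈ 𝔟 (a + single k 1)) :
    EventuallyPolynomial (hilbertFunction π 𝔞 𝔟) := by
  classical
  induction hc : T.card using Nat.strong_induction_on generalizing T 𝔞 𝔟 with
  | _ c ih =>
  -- If every generator of some weight i acts as zero, the Hilbert function vanishes for large n i:
  -- by pigeonhole some `a k` with `π k = i` exceeds the Artin–Rees bound, so the component of 𝔞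
  -- lies in `K k` times an earlier one, hence in 𝔟.
  by_cases hi : ∃ i, ∀ p ∈ T, π p.1 ≠ i
  · obtain ⟨i, hi⟩ := hi
    obtain ⟨N, hN⟩ := h𝔞.exists_le_mul
    refine EventuallyPolynomial.zero.congr (Fintype.card κ * N + 1) fun n hn => ?_
    refine (Finset.sum_eq_zero fun a ha => ?_).symm
    obtain ⟨k, hk, hak⟩ : ∃ k, π k = i ∧ N + 1 ≤ a k := by
      by_contra hcon
      push Not at hcon
      have h1 := hn i
      rw [← mem_weightFiber.1 ha, mapDomain_apply_eq_sum_ite] at h1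
      have h2 : (∑ k, if π k = i then a k else 0) ≤ ∑ _k : κ, N := by
        refine Finset.sum_le_sum fun k _ => ?_
        split_ifs with h
        · exact Nat.lt_succ_iff.1 (hcon k h)
        · exact Nat.zero_le _
      rw [Finset.sum_const, smul_eq_mul, Finset.card_univ] at h2
      omega
    obtain ⟨b, rfl⟩ := eq_add_single_of_ne_zero (show a k ≠ 0 by omega)
    have hbk : N ≤ b k := by simpa using hak
    have : 𝔞 (b + single k 1) ≤ 𝔟 (b + single k 1) := by
      refine (hN k b hbk).trans ?_
      rw [Ideal.mul_le]
      intro f hf x hx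
      have hsp : Ideal.span (s k : Set R) ≤
          Submodule.comap (LinearMap.mulRight R x) (𝔟 (b + single k 1)) :=
        Ideal.span_le.2 fun g hg => hkill k g hg (fun h => hi _ h hk) b x hx
      rw [hs] at hsp
      exact hsp hf
    rw [quotLength_eq_zero_of_le this]
    simp
  · push Not at hi
    -- Now T contains a generator of each weight i, and multiplication by it controls the difference
    -- in direction i.
    refine EventuallyPolynomial.of_forall_difference fun i => ?_
    obtain ⟨⟨k, f⟩, hkf, rfl⟩ := hi i
    have hf : f ∈ K k := hT _ hkf
    have hcard : (T.erase (k, f)).card < c := by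
      rw [← hc]
      exact Finset.card_erase_lt_of_mem hkf
    have h1 : EventuallyPolynomial (hilbertFunction π 𝔞 (imageFamily k f 𝔞 𝔟)) := by
      refine ih _ hcard (T.erase (k, f)) (fun p hp => hT p (Finset.mem_of_mem_erase hp)) h𝔞
        (h𝔞.imageFamily h𝔟 hle hf) (imageFamily_le h𝔞 hle hf)
        (fun a => (quotLength_lt_top_of_le (hfin a) (le_imageFamily a)
          (imageFamily_le h𝔞 hle hf a)).1) ?_ rfl
      intro l g hg hlg a x hx
      by_cases hlg' : (l, g) = (k, f)
      · obtain ⟨rfl, rfl⟩ := Prod.mk.inj hlg'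
        rw [imageFamily_add_single]
        exact Ideal.mem_sup_left (Ideal.mul_mem_mul (Ideal.mem_span_singleton_self _) hx)
      · exact le_imageFamily _ (hkill l g hg (fun h => hlg (Finset.mem_erase.2 ⟨hlg', h⟩)) a x hx)
    have h2 : EventuallyPolynomial (hilbertFunction π (kernelFamily k f 𝔞 𝔟) 𝔟) := by
      refine ih _ hcard (T.erase (k, f)) (fun p hp => hT p (Finset.mem_of_mem_erase hp))
        (h𝔞.kernelFamily h𝔟) h𝔟 (le_kernelFamily h𝔟 hle hf)
        (fun a => (quotLength_lt_top_of_le (hfin a) (le_kernelFamily h𝔟 hle hf a)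
          inf_le_left).2) ?_ rfl
      intro l g hg hlg a x hx
      by_cases hlg' : (l, g) = (k, f)
      · obtain ⟨rfl, rfl⟩ := Prod.mk.inj hlg'
        exact hx.2
      · exact hkill l g hg (fun h => hlg (Finset.mem_erase.2 ⟨hlg', h⟩)) a x hx.1
    refine ((h1.shift (Pi.single (π k) 1)).sub h2).congr 0 fun n _ => ?_
    exact (hilbertFunction_difference π h𝔞 h𝔟 hle hfin hf n).symm

/-- Hilbert functions of finite length subquotients of a multigraded Rees algebra are eventually
polynomial. -/
theorem eventuallyPolynomial_hilbertFunction [IsNoetherianRing R] (π : κ → Fin r)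
    (h𝔞 : IsStableFamily K 𝔞) (h𝔟 : IsStableFamily K 𝔟) (hle : ∀ a, 𝔟 a ≤ 𝔞 a)
    (hfin : ∀ a, quotLength (𝔞 a) (𝔟 a) < ⊤) :
    EventuallyPolynomial (hilbertFunction π 𝔞 𝔟) := by
  classical
  choose s hs using fun k => IsNoetherian.noetherian (K k)
  refine eventuallyPolynomial_hilbertFunction_of_forall_notMem π s hs
    (Finset.univ.biUnion fun k => (s k).image (Prod.mk k)) ?_ h𝔞 h𝔟 hle hfin ?_
  · intro p hp
    simp only [Finset.mem_biUnion, Finset.mem_univ, true_and, Finset.mem_image] at hp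
    obtain ⟨k, f, hf, rfl⟩ := hp
    rw [← hs]
    exact Ideal.subset_span hf
  · intro k f hf hkf
    refine (hkf ?_).elim
    simp only [Finset.mem_biUnion, Finset.mem_univ, true_and, Finset.mem_image]
    exact ⟨k, f, hf, rfl⟩

end Families

end HilbertFunction

/-! ### Quotients of products of powers as Hilbert functions. -/

section PowerQuotients

open Finsupp

variable {R : Type*} [CommRing R]

theorem quotLength_eq_sum_range {c : ℕ → Ideal R} (m : ℕ) (hc : ∀ t < m, c (t + 1) ≤ c t) :
    quotLength (c 0) (c m) = ∑ t ∈ Finset.range m, quotLength (c t) (c (t + 1)) := by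
  have hle : ∀ s ≤ m, c s ≤ c 0 := by
    intro s hs
    induction s with
    | zero => exact le_rfl
    | succ s ih => exact (hc s hs).trans (ih (by omega))
  induction m with
  | zero => simp [quotLength_self]
  | succ m ih =>
    rw [Finset.sum_range_succ, ← ih (fun t ht => hc t (by omega)) (fun s hs => hle s (by omega)),
      quotLength_add (hc m (by omega)) (hle m (by omega))]

/-- The chain B^t A^(m+1-t) P trades one factor A for B at each step, so each successive quotient
has the form CA/CB. -/
theorem quotLength_pow_mul {A B : Ideal R} (hBA : B ≤ A) (P : Ideal R) (m : ℕ) :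
    quotLength (A ^ (m + 1) * P) (B ^ (m + 1) * P) = ∑ t ∈ Finset.range (m + 1),
      quotLength (B ^ t * A ^ (m - t) * P * A) (B ^ t * A ^ (m - t) * P * B) := by
  have h0 : ∀ t < m + 1, B ^ t * A ^ (m + 1 - t) * P = B ^ t * A ^ (m - t) * P * A := by
    intro t ht
    rw [show m + 1 - t = m - t + 1 by omega, pow_succ]
    ring
  have h1 : ∀ t < m + 1, B ^ (t + 1) * A ^ (m + 1 - (t + 1)) * P =
      B ^ t * A ^ (m - t) * P * B := by
    intro t ht
    rw [show m + 1 - (t + 1) = m - t by omega, pow_succ]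
    ring
  have key := quotLength_eq_sum_range (c := fun t => B ^ t * A ^ (m + 1 - t) * P) (m + 1) ?_
  · simp only [pow_zero, one_mul, Nat.sub_zero, Nat.sub_self, mul_one] at key
    rw [key]
    refine Finset.sum_congr rfl fun t ht => ?_
    rw [h0 t (Finset.mem_range.1 ht), h1 t (Finset.mem_range.1 ht)]
  · intro t ht
    simp only [h0 t ht, h1 t ht]
    exact Ideal.mul_mono_right hBA

theorem quotLength_pow_mul_lt_top [IsNoetherianRing R] {A B : Ideal R} (hBA : B ≤ A)
    (h : quotLength A B < ⊤) (P : Ideal R) (m : ℕ) :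
    quotLength (A ^ m * P) (B ^ m * P) < ⊤ := by
  cases m with
  | zero => simp [quotLength_self]
  | succ m =>
    rw [quotLength_pow_mul hBA]
    exact WithTop.sum_lt_top.2 fun t _ => quotLength_mul_lt_top _ h

variable {r : ℕ}

theorem isStableFamily_mul_idealPow {κ : Type*} [Fintype κ] (K : κ → Ideal R) (A : Ideal R) :
    IsStableFamily K (fun a => idealPow K a * A) where
  le a := Ideal.mul_le_left
  mul_le k a := by
    rw [idealPow_add, idealPow_single, ← mul_assoc, mul_comm (K k)]

/-- The Rees algebra is that of B (index `none`), A (index `some i`) and the other `L j`. Both A and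
B get weight i, so a multi-index of weight n is determined by the exponent t of B, that of A being n
i - t. This is the sum in `quotLength_pow_mul`. -/
theorem hilbertFunction_option (L : Fin r → Ideal R) (i : Fin r) {A B : Ideal R} (n : Fin r → ℕ) :
    hilbertFunction (fun o : Option (Fin r) => o.elim i id)
      (fun a => idealPow (fun o : Option (Fin r) => o.elim B (Function.update L i A)) a * A)
      (fun a => idealPow (fun o : Option (Fin r) => o.elim B (Function.update L i A)) a * B) n =
    ∑ t ∈ Finset.range (n i + 1),
      ((quotLength (B ^ t * A ^ (n i - t) * (∏ j ∈ Finset.univ.erase i, L j ^ n j) * A)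
        (B ^ t * A ^ (n i - t) * (∏ j ∈ Finset.univ.erase i, L j ^ n j) * B)).toNat : ℚ) := by
  classical
  symm
  have hmap : ∀ (a : Option (Fin r) →₀ ℕ) (j : Fin r),
      mapDomain (fun o : Option (Fin r) => o.elim i id) a j =
        (if i = j then a none else 0) + a (some j) := by
    intro a j
    rw [mapDomain_apply_eq_sum_ite, Fintype.sum_option]
    change (if i = j then a none else 0) + (∑ k, if k = j then a (some k) else 0) = _
    simp
  refine Finset.sum_nbij (fun t => equivFunOnFinite.symm
    (fun o : Option (Fin r) => o.elim t (Function.update n i (n i - t)))) ?_ ?_ ?_ ?_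
  · intro t ht
    rw [Finset.mem_range] at ht
    rw [mem_weightFiber]
    funext j
    rw [hmap]
    by_cases hj : i = j
    · subst hj
      simp
      omega
    · simp [hj, Function.update_of_ne (Ne.symm hj)]
  · intro t _ u _ htu
    have := DFunLike.congr_fun htu none
    simpa using this
  · intro a ha
    have ha' := mem_weightFiber.1 ha
    refine ⟨a none, ?_, ?_⟩
    · have := congrFun ha' i
      rw [hmap, if_pos rfl] at this
      simp
      omega
    · ext o
      rw [equivFunOnFinite_symm_apply_apply]
      cases o with
      | none => rfl
      | some j =>
        have := congrFun ha' j
        rw [hmap] at this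
        by_cases hj : i = j
        · subst hj
          simp at this ⊢
          omega
        · rw [if_neg hj, zero_add] at this
          simp [Function.update_of_ne (Ne.symm hj), this]
  · intro t _
    have : idealPow (fun o : Option (Fin r) => o.elim B (Function.update L i A))
        (equivFunOnFinite.symm
          (fun o : Option (Fin r) => o.elim t (Function.update n i (n i - t)))) =
        B ^ t * A ^ (n i - t) * (∏ j ∈ Finset.univ.erase i, L j ^ n j) := by
      rw [idealPow, Fintype.prod_option, ← Finset.mul_prod_erase _ _ (Finset.mem_univ i), mul_assoc]
      simp only [equivFunOnFinite_symm_apply_apply, Option.elim, Function.update_self]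
      congr 2
      refine Finset.prod_congr rfl fun j hj => ?_
      have hj' := Finset.ne_of_mem_erase hj
      rw [Function.update_of_ne hj', Function.update_of_ne hj']
    simp only [this]

theorem eventuallyPolynomial_quotLength_pow_mul [IsNoetherianRing R] (L : Fin r → Ideal R)
    (i : Fin r) {A B : Ideal R} (hBA : B ≤ A) (h : quotLength A B < ⊤) :
    EventuallyPolynomial fun n => ((quotLength (A ^ n i * ∏ j ∈ Finset.univ.erase i, L j ^ n j)
      (B ^ n i * ∏ j ∈ Finset.univ.erase i, L j ^ n j)).toNat : ℚ) := by
  classical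
  -- The filtration has exponent m + 1 while the Hilbert function is taken at m.
  refine EventuallyPolynomial.of_shift (Pi.single i 1) ?_
  refine (eventuallyPolynomial_hilbertFunction (fun o : Option (Fin r) => o.elim i id)
    (isStableFamily_mul_idealPow
      (fun o : Option (Fin r) => o.elim B (Function.update L i A)) A)
    (isStableFamily_mul_idealPow _ B) (fun a => Ideal.mul_mono_right hBA)
    (fun a => quotLength_mul_lt_top _ h)).congr 0 fun n _ => ?_
  have hP : ∏ j ∈ Finset.univ.erase i, L j ^ (n + Pi.single i 1 : Fin r → ℕ) j =
      ∏ j ∈ Finset.univ.erase i, L j ^ n j := by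
    refine Finset.prod_congr rfl fun j hj => ?_
    simp [Finset.ne_of_mem_erase hj]
  rw [hilbertFunction_option, hP, Pi.add_apply, Pi.single_eq_same, quotLength_pow_mul hBA,
    ENat.toNat_sum fun t _ => (quotLength_mul_lt_top _ h).ne, Nat.cast_sum]

/-- The product of powers in which the first `m` ideals are taken from `I` and the others
from `J`. -/
def hybridPower (I J : Fin r → Ideal R) (n : Fin r → ℕ) (m : ℕ) : Ideal R :=
  ∏ j : Fin r, (if (j : ℕ) < m then I j else J j) ^ n j

theorem hybridPower_eq (I J : Fin r → Ideal R) (n : Fin r → ℕ) (i : Fin r) :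
    hybridPower I J n i = J i ^ n i * ∏ j ∈ Finset.univ.erase i,
        (if (j : ℕ) < i then I j else J j) ^ n j ∧
      hybridPower I J n (i + 1) = I i ^ n i * ∏ j ∈ Finset.univ.erase i,
        (if (j : ℕ) < i then I j else J j) ^ n j := by
  classical
  constructor
  · rw [hybridPower, ← Finset.mul_prod_erase _ _ (Finset.mem_univ i), if_neg (lt_irrefl _)]
  · rw [hybridPower, ← Finset.mul_prod_erase _ _ (Finset.mem_univ i), if_pos (Nat.lt_succ_self _)]
    congr 1
    refine Finset.prod_congr rfl fun j hj => ?_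
    have : (j : ℕ) ≠ i := fun h => Finset.ne_of_mem_erase hj (Fin.ext h)
    simp only [show ((j : ℕ) < i + 1) ↔ (j : ℕ) < i by omega]

/-- The hybrid products form a descending chain from the powers of J to those of I, changing one
ideal at a time. -/
theorem quotLength_multiPower_eq_sum (I J : Fin r → Ideal R) (hIJ : ∀ i, I i ≤ J i)
    (n : Fin r → ℕ) : quotLength (multiPower J n) (multiPower I n) =
      ∑ i : Fin r, quotLength (hybridPower I J n i) (hybridPower I J n (i + 1)) := by
  have h0 : multiPower J n = hybridPower I J n 0 := by simp [multiPower, hybridPower]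
  have h1 : multiPower I n = hybridPower I J n r := by simp [multiPower, hybridPower]
  rw [h0, h1, quotLength_eq_sum_range, Finset.sum_range]
  intro t ht
  obtain ⟨e1, e2⟩ := hybridPower_eq I J n ⟨t, ht⟩
  rw [show hybridPower I J n t = _ from e1, show hybridPower I J n (t + 1) = _ from e2]
  exact Ideal.mul_mono_left (Ideal.pow_right_mono (hIJ _) _)

theorem quotLength_hybridPower_lt_top [IsNoetherianRing R] {I J : Fin r → Ideal R}
    (hIJ : ∀ i, I i ≤ J i) (hlen : ∀ i, quotLength (J i) (I i) < ⊤) (n : Fin r → ℕ) (i : Fin r) :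
    quotLength (hybridPower I J n i) (hybridPower I J n (i + 1)) < ⊤ := by
  rw [(hybridPower_eq I J n i).1, (hybridPower_eq I J n i).2]
  exact quotLength_pow_mul_lt_top (hIJ i) (hlen i) _ _

theorem quotLength_multiPower_lt_top [IsNoetherianRing R] {I J : Fin r → Ideal R}
    (hIJ : ∀ i, I i ≤ J i) (hlen : ∀ i, quotLength (J i) (I i) < ⊤) (n : Fin r → ℕ) :
    quotLength (multiPower J n) (multiPower I n) < ⊤ := by
  rw [quotLength_multiPower_eq_sum I J hIJ]
  exact WithTop.sum_lt_top.2 fun i _ => quotLength_hybridPower_lt_top hIJ hlen n i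

theorem eventuallyPolynomial_quotLength_multiPower [IsNoetherianRing R] {I J : Fin r → Ideal R}
    (hIJ : ∀ i, I i ≤ J i) (hlen : ∀ i, quotLength (J i) (I i) < ⊤) :
    EventuallyPolynomial fun n => ((quotLength (multiPower J n) (multiPower I n)).toNat : ℚ) := by
  have := EventuallyPolynomial.sum Finset.univ fun i : Fin r =>
    eventuallyPolynomial_quotLength_pow_mul (fun j => if (j : ℕ) < i then I j else J j) i
      (hIJ i) (hlen i)
  refine this.congr 0 fun n _ => ?_
  rw [quotLength_multiPower_eq_sum I J hIJ,
    ENat.toNat_sum fun i _ => (quotLength_hybridPower_lt_top hIJ hlen n i).ne, Nat.cast_sum]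
  refine Finset.sum_congr rfl fun i _ => ?_
  rw [(hybridPower_eq I J n i).1, (hybridPower_eq I J n i).2]

end PowerQuotients

/-! ### Growth of powers of a subspace in a finitely generated algebra. -/

section Growth

open Pointwise

/-- Lying over lifts the bottom of a prime chain, and going up lifts the rest. -/
theorem ringKrullDim_le_of_injective_of_isIntegral {A B : Type*} [CommRing A] [CommRing B]
    [Algebra A B] [Algebra.IsIntegral A B] (h : Function.Injective (algebraMap A B)) :
    ringKrullDim A ≤ ringKrullDim B := by
  refine iSup_le fun l => ?_
  obtain ⟨P, -, hP, hPc⟩ := Ideal.exists_ideal_over_prime_of_isIntegral l.head.asIdeal (⊥ : Ideal B)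
    (by
      rw [← RingHom.ker_eq_comap_bot, (RingHom.injective_iff_ker_eq_bot _).1 h]
      exact bot_le)
  have : P.LiesOver l.head.asIdeal := ⟨hPc.symm⟩
  obtain ⟨L, hL, -⟩ := Ideal.exists_ltSeries_of_hasGoingUp l P
  rw [← hL]
  exact le_iSup (fun p : LTSeries (PrimeSpectrum B) => ((p.length : ℕ∞) : WithBot ℕ∞)) L

variable {k F : Type*} [Field k] [CommRing F] [Algebra k F]

/-- The monomials of degree at most `m` in each of finitely many elements. -/
def boundedMonomials {s : ℕ} (z : Fin s → F) (m : ℕ) : Set F :=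
  Set.range fun a : Fin s → Fin (m + 1) => ∏ i, z i ^ (a i : ℕ)

theorem boundedMonomials_mono {s : ℕ} (z : Fin s → F) {m m' : ℕ} (h : m ≤ m') :
    boundedMonomials z m ⊆ boundedMonomials z m' := by
  rintro _ ⟨a, rfl⟩
  exact ⟨fun i => ⟨a i, by have := (a i).2; omega⟩, rfl⟩

theorem boundedMonomials_mul {s : ℕ} (z : Fin s → F) (m m' : ℕ) :
    boundedMonomials z m * boundedMonomials z m' ⊆ boundedMonomials z (m + m') := by
  rintro _ ⟨_, ⟨a, rfl⟩, _, ⟨b, rfl⟩, rfl⟩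
  refine ⟨fun i => ⟨a i + b i, by have := (a i).2; have := (b i).2; omega⟩, ?_⟩
  simp [pow_add, Finset.prod_mul_distrib]

theorem ncard_boundedMonomials_le {s : ℕ} (z : Fin s → F) (m : ℕ) :
    (boundedMonomials z m).ncard ≤ (m + 1) ^ s := by
  rw [boundedMonomials, ← Set.image_univ]
  refine (Set.ncard_image_le Set.finite_univ).trans ?_
  rw [Set.ncard_univ, Nat.card_eq_fintype_card]
  simp

theorem finite_boundedMonomials {s : ℕ} (z : Fin s → F) (m : ℕ) : (boundedMonomials z m).Finite :=
  Set.finite_range _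

theorem exists_aeval_mem_span_boundedMonomials {s : ℕ} (z : Fin s → F)
    (p : MvPolynomial (Fin s) k) :
    ∃ m, MvPolynomial.aeval z p ∈ Submodule.span k (boundedMonomials z m) := by
  induction p using MvPolynomial.induction_on' with
  | monomial a c =>
    refine ⟨∑ i, a i, ?_⟩
    rw [MvPolynomial.aeval_monomial, ← Algebra.smul_def, Finsupp.prod_fintype _ _ (by simp)]
    refine Submodule.smul_mem _ _ (Submodule.subset_span ⟨fun i => ⟨a i, ?_⟩, rfl⟩)
    exact Nat.lt_succ_of_le
      (Finset.single_le_sum (f := fun i => a i) (fun _ _ => Nat.zero_le _) (Finset.mem_univ i))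
  | add p q hp hq =>
    obtain ⟨m, hm⟩ := hp
    obtain ⟨m', hm'⟩ := hq
    refine ⟨m + m', ?_⟩
    rw [map_add]
    exact Submodule.add_mem _
      (Submodule.span_mono (boundedMonomials_mono z (Nat.le_add_right _ _)) hm)
      (Submodule.span_mono (boundedMonomials_mono z (Nat.le_add_left _ _)) hm')

/-- In a finitely generated algebra of Krull dimension at most `D`, the powers of a finite
dimensional subspace grow at most like a polynomial of degree `D`. -/
theorem exists_finrank_pow_le [Algebra.FiniteType k F] {D : ℕ} (hD : ringKrullDim F ≤ D)
    {V : Submodule k F} (hV : V.FG) :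
    ∃ C : ℕ, ∀ n : ℕ, Module.finrank k (V ^ n : Submodule k F) ≤ C * (n + 1) ^ D := by
  classical
  rcases subsingleton_or_nontrivial F with hF | hF
  · exact ⟨0, fun n => by rw [Module.finrank_zero_of_subsingleton]; exact Nat.zero_le _⟩
  -- Noether normalization: F is finite over a polynomial ring in s variables, and integrality gives
  -- s ≤ D.
  obtain ⟨s, g, hg, hfin⟩ := exists_finite_inj_algHom_of_fg k F
  set z : Fin s → F := fun i => g (MvPolynomial.X i) with hz
  have hgz : ∀ p, g p = MvPolynomial.aeval z p := fun p => by
    rw [MvPolynomial.aeval_unique g]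
    rfl
  algebraize [g.toRingHom]
  have hfin' : Module.Finite (MvPolynomial (Fin s) k) F := hfin
  have hsD : s ≤ D := by
    have h1 : ringKrullDim (MvPolynomial (Fin s) k) ≤ ringKrullDim F :=
      ringKrullDim_le_of_injective_of_isIntegral hg
    rw [MvPolynomial.ringKrullDim_of_isNoetherianRing, ringKrullDim_eq_zero_of_field, zero_add,
      Nat.card_eq_fintype_card, Fintype.card_fin] at h1
    exact_mod_cast h1.trans hD
  obtain ⟨G, hG⟩ := Module.Finite.fg_top (R := MvPolynomial (Fin s) k) (M := F)
  set U : ℕ → Submodule k F := fun m => Submodule.span k (boundedMonomials z m) with hU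
  set W : ℕ → Submodule k F := fun m => U m * Submodule.span k (G : Set F) with hW
  have hUmono : ∀ {m m'}, m ≤ m' → U m ≤ U m' := fun h =>
    Submodule.span_mono (boundedMonomials_mono z h)
  have hWmono : ∀ {m m'}, m ≤ m' → W m ≤ W m' := fun h => mul_le_mul_left (hUmono h) _
  have hUmul : ∀ m m', U m * U m' ≤ U (m + m') := fun m m' => by
    rw [hU]
    simp only [Submodule.span_mul_span]
    exact Submodule.span_mono (boundedMonomials_mul z m m')
  have hmem : ∀ f : F, ∃ m, f ∈ W m := by
    intro f
    have hf : f ∈ Submodule.span (MvPolynomial (Fin s) k) (G : Set F) := by rw [hG]; trivial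
    induction hf using Submodule.span_induction with
    | mem x hx =>
      refine ⟨0, ?_⟩
      rw [← one_mul x]
      exact Submodule.mul_mem_mul (Submodule.subset_span ⟨0, by simp⟩) (Submodule.subset_span hx)
    | zero => exact ⟨0, Submodule.zero_mem _⟩
    | add x y _ _ hx hy =>
      obtain ⟨m, hm⟩ := hx
      obtain ⟨m', hm'⟩ := hy
      exact ⟨m + m', Submodule.add_mem _ (hWmono (Nat.le_add_right _ _) hm)
        (hWmono (Nat.le_add_left _ _) hm')⟩
    | smul p x _ hx =>
      obtain ⟨m, hm⟩ := hx
      obtain ⟨m', hm'⟩ := exists_aeval_mem_span_boundedMonomials z p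
      refine ⟨m' + m, ?_⟩
      have h1 : p • x = MvPolynomial.aeval z p * x := by
        rw [Algebra.smul_def, ← hgz]
        rfl
      rw [h1]
      refine mul_le_mul_left (hUmul m' m) _ ?_
      rw [mul_assoc]
      exact Submodule.mul_mem_mul hm' hm
  have hfg : ∀ {V : Submodule k F}, V.FG → ∃ m, V ≤ W m := by
    rintro _ ⟨t, rfl⟩
    choose m hm using hmem
    refine ⟨∑ f ∈ t, m f, Submodule.span_le.2 fun f hf => hWmono ?_ (hm f)⟩
    exact Finset.single_le_sum (f := m) (fun _ _ => Nat.zero_le _) hf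
  obtain ⟨c₁, hc₁⟩ := hfg hV
  obtain ⟨c₂, hc₂⟩ := hfg ((Submodule.fg_span G.finite_toSet).mul
    (Submodule.fg_span (R := k) G.finite_toSet))
  obtain ⟨c₃, hc₃⟩ := hmem 1
  -- The three constants bound the monomial exponents needed for V, for products of two module
  -- generators, and for 1. Each further factor V thus costs at most c, and V^n stays in W(cn + c),
  -- whose dimension is O(n^s).
  set c := c₁ + c₂ + c₃ with hc
  have hVpow : ∀ n, V ^ n ≤ W (c * n + c) := by
    intro n
    induction n with
    | zero =>
      rw [pow_zero, Submodule.one_le]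
      exact hWmono (by omega) hc₃
    | succ n ih =>
      rw [pow_succ']
      calc V * V ^ n ≤ W c₁ * W (c * n + c) := mul_le_mul' hc₁ ih
        _ = (U c₁ * U (c * n + c)) * (Submodule.span k (G : Set F) * Submodule.span k (G : Set F)) := by
            rw [hW]; exact mul_mul_mul_comm _ _ _ _
        _ ≤ U (c₁ + (c * n + c)) * W c₂ := mul_le_mul' (hUmul _ _) hc₂
        _ = (U (c₁ + (c * n + c)) * U c₂) * Submodule.span k (G : Set F) := by
            rw [hW]; exact (mul_assoc _ _ _).symm
        _ ≤ W (c₁ + (c * n + c) + c₂) := mul_le_mul_left (hUmul _ _) _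
        _ ≤ W (c * (n + 1) + c) := hWmono (by rw [mul_add, mul_one]; omega)
  have hWrank : ∀ m, Module.finrank k (W m) ≤ (m + 1) ^ s * G.card ∧ Module.Finite k (W m) := by
    intro m
    set t := (finite_boundedMonomials z m).toFinset with ht
    have hWm : W m = Submodule.span k ((t * G : Finset F) : Set F) := by
      rw [Finset.coe_mul, ht, Set.Finite.coe_toFinset]
      exact Submodule.span_mul_span _ _ _
    rw [hWm]
    refine ⟨?_, Module.Finite.span_finset k _⟩
    refine (finrank_span_finset_le_card (R := k) _).trans (Finset.card_mul_le.trans ?_)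
    rw [ht, ← Set.ncard_eq_toFinset_card _ (finite_boundedMonomials z m)]
    exact Nat.mul_le_mul_right _ (ncard_boundedMonomials_le z m)
  refine ⟨G.card * (2 * c + 1) ^ D, fun n => ?_⟩
  have := (hWrank (c * n + c)).2
  refine (Submodule.finrank_mono (hVpow n)).trans ((hWrank _).1.trans ?_)
  have h1 : c * n + c + 1 ≤ (2 * c + 1) * (n + 1) := by nlinarith
  calc (c * n + c + 1) ^ s * G.card ≤ ((2 * c + 1) * (n + 1)) ^ s * G.card := by gcongr
    _ ≤ ((2 * c + 1) * (n + 1)) ^ D * G.card := by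
        gcongr
        · nlinarith
    _ = G.card * (2 * c + 1) ^ D * (n + 1) ^ D := by rw [mul_pow]; ring

end Growth

/-! ### Krull dimension of the Rees algebra and of its special fibre. -/

section ReesDimension

open Finsupp MvPolynomial

theorem le_natCast_of_add_one_le {x : WithBot ℕ∞} {e : ℕ}
    (h : x + 1 ≤ ((e + 1 : ℕ) : WithBot ℕ∞)) : x ≤ e := by
  induction x with
  | bot => exact bot_le
  | coe x =>
    induction x with
    | top =>
      have h' : (⊤ : ℕ∞) + 1 ≤ ((e + 1 : ℕ) : ℕ∞) := WithBot.coe_le_coe.1 h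
      rw [top_add, top_le_iff] at h'
      exact absurd h' (ENat.natCast_ne_top _)
    | coe x => norm_cast at h ⊢; omega

section Adjoin

variable {D E : Type*} [CommRing D] [CommRing E] [Algebra D E]

theorem exists_polynomial_surjective_adjoin_insert (s : Set E) (x : E) :
    ∃ φ : Polynomial (Algebra.adjoin D s) →+* Algebra.adjoin D (s ∪ {x}),
      Function.Surjective φ ∧ ∀ p, ((φ p : Algebra.adjoin D (s ∪ {x})) : E) = p.aeval x := by
  have h : ∀ p : Polynomial (Algebra.adjoin D s), p.aeval x ∈ Algebra.adjoin D (s ∪ {x}) := by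
    intro p
    rw [Algebra.adjoin_union_eq_adjoin_adjoin, Subalgebra.mem_restrictScalars,
      Algebra.adjoin_singleton_eq_range_aeval]
    exact ⟨p, rfl⟩
  refine ⟨(Polynomial.aeval x : Polynomial (Algebra.adjoin D s) →ₐ[_] E).toRingHom.codRestrict
    (Algebra.adjoin D (s ∪ {x})) h, ?_, fun p => rfl⟩
  rintro ⟨y, hy⟩
  have hy' := hy
  rw [Algebra.adjoin_union_eq_adjoin_adjoin, Subalgebra.mem_restrictScalars,
    Algebra.adjoin_singleton_eq_range_aeval] at hy'
  obtain ⟨p, hp⟩ := hy'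
  exact ⟨p, Subtype.ext hp⟩

variable [IsNoetherianRing D] {e : ℕ}

theorem isNoetherianRing_adjoin {s : Set E} (hs : s.Finite) :
    IsNoetherianRing (Algebra.adjoin D s) :=
  isNoetherianRing_of_fg ⟨hs.toFinset, by rw [hs.coe_toFinset]⟩

theorem ringKrullDim_adjoin_union_singleton_le {s : Set E} (hs : s.Finite) (x : E)
    (he : ringKrullDim (Algebra.adjoin D s) ≤ e) :
    ringKrullDim (Algebra.adjoin D (s ∪ {x})) ≤ (e + 1 : ℕ) := by
  have := isNoetherianRing_adjoin (D := D) hs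
  obtain ⟨φ, hφ, -⟩ := exists_polynomial_surjective_adjoin_insert (D := D) s x
  refine (ringKrullDim_le_of_surjective φ hφ).trans ?_
  rw [Polynomial.ringKrullDim_of_isNoetherianRing]
  exact (add_le_add_left he 1).trans (by norm_cast)

/-- The new algebra is a quotient of the polynomial ring over the old one by an ideal containing p ≠
0. In a domain this loses the dimension gained by the variable. -/
theorem ringKrullDim_adjoin_union_singleton_le_of_algebraic [IsDomain E] {s : Set E}
    (hs : s.Finite) {x : E} {p : Polynomial (Algebra.adjoin D s)} (hp : p ≠ 0)
    (hpx : p.aeval x = 0) (he : ringKrullDim (Algebra.adjoin D s) ≤ e) :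
    ringKrullDim (Algebra.adjoin D (s ∪ {x})) ≤ e := by
  have := isNoetherianRing_adjoin (D := D) hs
  obtain ⟨φ, hφ, hφp⟩ := exists_polynomial_surjective_adjoin_insert (D := D) s x
  have h1 := ringKrullDim_succ_le_of_surjective φ hφ (mem_nonZeroDivisors_of_ne_zero hp)
    (Subtype.ext ((hφp p).trans hpx))
  rw [Polynomial.ringKrullDim_of_isNoetherianRing] at h1
  exact le_natCast_of_add_one_le (h1.trans ((add_le_add_left he 1).trans (by norm_cast)))

end Adjoin

variable {κ : Type*} [Fintype κ]

/-- The Rees algebra of `m` ideals of a domain of dimension `d` has dimension at most `d + m`. -/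
theorem ringKrullDim_multiRees_le {D : Type*} [CommRing D] [IsDomain D] [IsNoetherianRing D] {d : ℕ}
    (hd : ringKrullDim D ≤ d) (K : κ → Ideal D) :
    ringKrullDim (multiRees K) ≤ (d + Fintype.card κ : ℕ) := by
  classical
  choose s hs using fun k => IsNoetherian.noetherian (K k)
  have hx : ∀ k, ∃ x ∈ K k, K k ≠ ⊥ → x ≠ 0 := by
    intro k
    by_cases hk : K k = ⊥
    · exact ⟨0, Ideal.zero_mem _, fun h => (h hk).elim⟩
    · obtain ⟨x, hx, hx0⟩ := Submodule.exists_mem_ne_zero_of_ne_bot hk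
      exact ⟨x, hx, fun _ => hx0⟩
  choose x hxK hx0 using hx
  -- One element x_k X_k per ideal raises the dimension by at most 1. Every remaining generator c
  -- X_k is algebraic over these and raises it no further.
  set y : κ → MvPolynomial κ D := fun k => monomial (single k 1) (x k) with hy
  have h1 : ∀ U : Finset κ, ringKrullDim (Algebra.adjoin D (y '' (U : Set κ))) ≤
      (d + U.card : ℕ) := by
    intro U
    induction U using Finset.induction_on with
    | empty =>
      rw [Finset.coe_empty, Set.image_empty, Algebra.adjoin_empty, Finset.card_empty, add_zero]
      refine le_trans ?_ hd
      refine ringKrullDim_le_of_surjective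
        (algebraMap D (⊥ : Subalgebra D (MvPolynomial κ D))) ?_
      rintro ⟨z, hz⟩
      obtain ⟨c, hc⟩ := Algebra.mem_bot.1 hz
      exact ⟨c, Subtype.ext hc⟩
    | insert k U hk ih =>
      rw [Finset.coe_insert, Set.image_insert_eq, Set.insert_eq, Set.union_comm,
        Finset.card_insert_of_notMem hk, ← add_assoc]
      exact ringKrullDim_adjoin_union_singleton_le (U.finite_toSet.image _) _ ih
  set G : Finset (MvPolynomial κ D) :=
    Finset.univ.biUnion fun k => (s k).image (monomial (single k 1)) with hG
  have h2 : ∀ T ⊆ G, ringKrullDim (Algebra.adjoin D (Set.range y ∪ (T : Set (MvPolynomial κ D)))) ≤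
      (d + Fintype.card κ : ℕ) := by
    intro T
    induction T using Finset.induction_on with
    | empty =>
      intro _
      rw [Finset.coe_empty, Set.union_empty]
      have := h1 Finset.univ
      rwa [Finset.coe_univ, Set.image_univ, Finset.card_univ] at this
    | insert g T hg ih =>
      intro hT
      have hT' := (Finset.insert_subset_iff.1 hT)
      rw [Finset.coe_insert, Set.insert_eq, Set.union_comm {g}, ← Set.union_assoc]
      obtain ⟨k, -, hk⟩ := Finset.mem_biUnion.1 hT'.1
      obtain ⟨c, hc, rfl⟩ := Finset.mem_image.1 hk
      have hfin : (Set.range y ∪ (T : Set (MvPolynomial κ D))).Finite :=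
        (Set.finite_range y).union T.finite_toSet
      set B := Algebra.adjoin D (Set.range y ∪ (T : Set (MvPolynomial κ D))) with hB
      have hyB : y k ∈ B := Algebra.subset_adjoin (Or.inl ⟨k, rfl⟩)
      have hcK : c ∈ K k := by rw [← hs]; exact Submodule.subset_span hc
      by_cases hk0 : K k = ⊥
      · rw [hk0, Ideal.mem_bot] at hcK
        refine ringKrullDim_adjoin_union_singleton_le_of_algebraic hfin
          (p := Polynomial.X) Polynomial.X_ne_zero ?_ (ih hT'.2)
        rw [Polynomial.aeval_X, hcK, map_zero]
      -- The relation is x_k T - c y_k, which vanishes at T = c X_k and has leading coefficient x_k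
      -- ≠ 0.
      · refine ringKrullDim_adjoin_union_singleton_le_of_algebraic hfin
          (p := Polynomial.C (algebraMap D B (x k)) * Polynomial.X +
            Polynomial.C (-(algebraMap D B c * ⟨y k, hyB⟩))) ?_ ?_ (ih hT'.2)
        · intro h0
          have h3 := congrArg (fun q => ((Polynomial.coeff q 1 : B) : MvPolynomial κ D)) h0
          simp only [Polynomial.coeff_add, Polynomial.coeff_C_mul, Polynomial.coeff_X_one, mul_one,
            Polynomial.coeff_C_succ, add_zero, Polynomial.coeff_zero] at h3
          exact hx0 k hk0 (C_injective κ D (h3.trans (map_zero C).symm))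
        · rw [map_add, map_mul, Polynomial.aeval_C, Polynomial.aeval_X, Polynomial.aeval_C]
          change C (x k) * monomial (single k 1) c + -(C c * monomial (single k 1) (x k)) = 0
          rw [C_mul_monomial, C_mul_monomial, mul_comm, add_neg_cancel]
  have h3 : Algebra.adjoin D (Set.range y ∪ (G : Set (MvPolynomial κ D))) = multiRees K := by
    apply le_antisymm
    · refine Algebra.adjoin_le (Set.union_subset ?_ ?_)
      · rintro _ ⟨k, rfl⟩
        exact monomial_mem_multiRees (by rw [idealPow_single]; exact hxK k)
      · intro g hg
        obtain ⟨k, -, hk⟩ := Finset.mem_biUnion.1 hg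
        obtain ⟨c, hc, rfl⟩ := Finset.mem_image.1 hk
        refine monomial_mem_multiRees ?_
        rw [idealPow_single, ← hs]
        exact Submodule.subset_span hc
    · rw [← adjoin_monomial_eq_multiRees hs]
      refine Algebra.adjoin_mono (Set.iUnion_subset fun k => ?_)
      rintro _ ⟨c, hc, rfl⟩
      exact Or.inr (Finset.mem_biUnion.2
        ⟨k, Finset.mem_univ k, Finset.mem_image.2 ⟨c, hc, rfl⟩⟩)
  rw [← h3]
  exact h2 G subset_rfl

theorem ringKrullDim_quotient_le_of_forall_isPrime {S : Type*} [CommRing S] {I : Ideal S}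
    {e : WithBot ℕ∞} (h : ∀ Q : Ideal S, Q.IsPrime → I ≤ Q → ringKrullDim (S ⧸ Q) ≤ e) :
    ringKrullDim (S ⧸ I) ≤ e := by
  rw [ringKrullDim_quotient]
  refine iSup_le fun l => ?_
  refine le_trans ?_ (h l.head.1.asIdeal l.head.1.2 l.head.2)
  rw [ringKrullDim_quotient]
  let L : LTSeries (PrimeSpectrum.zeroLocus (l.head.1.asIdeal : Set S)) :=
    { length := l.length
      toFun := fun i => ⟨(l i).1, l.head_le i⟩
      step := fun i => l.step i }
  exact le_iSup (fun p : LTSeries (PrimeSpectrum.zeroLocus (l.head.1.asIdeal : Set S)) =>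
    ((p.length : ℕ∞) : WithBot ℕ∞)) L

variable {R : Type*} [CommRing R]

theorem idealPow_map {A : Type*} [CommRing A] (f : R →+* A) (K : κ → Ideal R) (a : κ →₀ ℕ) :
    idealPow (fun k => (K k).map f) a = (idealPow K a).map f := by
  have := map_prod (Ideal.mapHom f) (fun k => K k ^ a k) Finset.univ
  exact (Finset.prod_congr rfl fun k _ => (Ideal.map_pow f (K k) (a k)).symm).trans this.symm

/-- Base change of the Rees algebra along a ring homomorphism. -/
noncomputable def multiReesMap {A : Type*} [CommRing A] (f : R →+* A) (K : κ → Ideal R) :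
    multiRees K →+* multiRees (fun k => (K k).map f) :=
  ((MvPolynomial.map f).comp (multiRees K).val.toRingHom).codRestrict _ fun p => by
    intro a
    change coeff a (MvPolynomial.map f p.1) ∈ _
    rw [coeff_map, idealPow_map]
    exact Ideal.mem_map_of_mem f (p.2 a)

theorem coe_multiReesMap {A : Type*} [CommRing A] (f : R →+* A) (K : κ → Ideal R)
    (p : multiRees K) : (multiReesMap f K p : MvPolynomial κ A) = MvPolynomial.map f p := rfl

theorem multiReesMap_surjective {A : Type*} [CommRing A] {f : R →+* A}
    (hf : Function.Surjective f) (K : κ → Ideal R) : Function.Surjective (multiReesMap f K) := by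
  intro q
  have : ∀ a, ∃ c ∈ idealPow K a, f c = coeff a q.1 := by
    intro a
    have := q.2 a
    rw [idealPow_map] at this
    exact (Ideal.mem_map_iff_of_surjective f hf).1 this
  choose c hc hfc using this
  refine ⟨⟨∑ a ∈ q.1.support, monomial a (c a),
    (multiRees K).sum_mem fun a _ => monomial_mem_multiRees (hc a)⟩, Subtype.ext ?_⟩
  rw [coe_multiReesMap]
  change MvPolynomial.map f (∑ a ∈ q.1.support, monomial a (c a)) = q.1
  rw [map_sum]
  simp only [map_monomial, hfc]
  exact q.1.as_sum.symm

/-- The special fibre of the Rees algebra of `m` ideals of a local ring of dimension `d > 0` has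
dimension less than `d + m`. -/
theorem ringKrullDim_multiRees_quotient_le [IsLocalRing R] [IsNoetherianRing R] {d e : ℕ}
    (hd : ringKrullDim R = d) (hd0 : d ≠ 0) (he : d + Fintype.card κ = e + 1) (K : κ → Ideal R) :
    ringKrullDim (multiRees K ⧸
      (IsLocalRing.maximalIdeal R).map (algebraMap R (multiRees K))) ≤ e := by
  refine ringKrullDim_quotient_le_of_forall_isPrime fun Q hQ hmQ => ?_
  obtain ⟨P, hP, hPQ⟩ := Ideal.exists_minimalPrimes_le (I := ⊥) (J := Q) bot_le
  obtain ⟨P', hP', hP'P⟩ := Ideal.exists_comap_eq_of_mem_minimalPrimes_of_injective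
    (f := (multiRees K).val.toRingHom) Subtype.val_injective P hP
  have : (P'.comap (C : R →+* MvPolynomial κ R)).IsPrime := Ideal.comap_isPrime _ _
  obtain ⟨p, hp, hpP'⟩ := Ideal.exists_minimalPrimes_le (I := ⊥)
    (J := P'.comap (C : R →+* MvPolynomial κ R)) bot_le
  have hpp : p.IsPrime := hp.1.1
  -- Since d > 0, the maximal ideal is not minimal. An x in it outside p is nonzero in the Rees
  -- algebra over R/p but dies modulo Q, so the dimension drops by at least one.
  have hpm : ¬ IsLocalRing.maximalIdeal R ≤ p := by
    intro hle
    have hmp : IsLocalRing.maximalIdeal R = p :=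
      le_antisymm hle (IsLocalRing.le_maximalIdeal hpp.ne_top)
    have h1 := Ideal.height_eq_zero_iff.2 hp
    have h2 := IsLocalRing.maximalIdeal_height_eq_ringKrullDim (R := R)
    rw [hmp, h1, hd] at h2
    exact hd0 (by exact_mod_cast h2.symm)
  obtain ⟨x, hxm, hxp⟩ := Set.not_subset.1 hpm
  set ψ := multiReesMap (Ideal.Quotient.mk p) K with hψ
  have hψs : Function.Surjective ψ := multiReesMap_surjective Ideal.Quotient.mk_surjective K
  set w := ψ (algebraMap R _ x) with hw
  have hw0 : w ≠ 0 := by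
    intro h0
    have h1 : MvPolynomial.map (Ideal.Quotient.mk p) (C x : MvPolynomial κ R) = 0 :=
      congrArg Subtype.val h0
    rw [map_C, map_eq_zero_iff _ (C_injective κ _), Ideal.Quotient.eq_zero_iff_mem] at h1
    exact hxp h1
  have hdim : ringKrullDim (multiRees (fun k => (K k).map (Ideal.Quotient.mk p))) ≤
      (d + Fintype.card κ : ℕ) :=
    ringKrullDim_multiRees_le ((ringKrullDim_quotient_le p).trans hd.le) _
  have hker : RingHom.ker ψ ≤ RingHom.ker (Ideal.Quotient.mk Q) := by
    intro f hf
    rw [Ideal.mk_ker]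
    refine hPQ ?_
    rw [← hP'P]
    change f.1 ∈ P'
    rw [f.1.as_sum]
    refine Ideal.sum_mem _ fun a _ => ?_
    have h1 : MvPolynomial.map (Ideal.Quotient.mk p) f.1 = 0 := congrArg Subtype.val hf
    have h2 : coeff a f.1 ∈ p := by
      rw [← Ideal.Quotient.eq_zero_iff_mem, ← coeff_map, h1, coeff_zero]
    have h3 : C (coeff a f.1) * monomial a 1 ∈ P' := Ideal.mul_mem_right _ _ (hpP' h2)
    rwa [C_mul_monomial, mul_one] at h3
  set ρ := RingHom.liftOfSurjective ψ hψs ⟨Ideal.Quotient.mk Q, hker⟩ with hρ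
  have hρψ : ∀ f, ρ (ψ f) = Ideal.Quotient.mk Q f := fun f =>
    RingHom.liftOfRightInverse_comp_apply _ _ _ ⟨Ideal.Quotient.mk Q, hker⟩ f
  have hρs : Function.Surjective ρ := fun z => by
    obtain ⟨f, rfl⟩ := Ideal.Quotient.mk_surjective z
    exact ⟨ψ f, hρψ f⟩
  have hfinal := ringKrullDim_succ_le_of_surjective ρ hρs (mem_nonZeroDivisors_of_ne_zero hw0)
    (by
      rw [hw, hρψ, Ideal.Quotient.eq_zero_iff_mem]
      exact hmQ (Ideal.mem_map_of_mem _ hxm))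
  exact le_natCast_of_add_one_le (hfinal.trans (hdim.trans (by rw [he])))

theorem ringKrullDim_le_of_multiRees_surjective [IsLocalRing R] [IsNoetherianRing R] {d e : ℕ}
    (hd : ringKrullDim R = d) (hd0 : d ≠ 0) (he : d + Fintype.card κ = e + 1) {K : κ → Ideal R}
    {F : Type*} [CommRing F] (θ : multiRees K →+* F) (hθ : Function.Surjective θ)
    (hθm : (IsLocalRing.maximalIdeal R).map (algebraMap R (multiRees K)) ≤ RingHom.ker θ) :
    ringKrullDim F ≤ e :=
  (ringKrullDim_le_of_surjective _ (Ideal.Quotient.lift_surjective_of_surjective _ hθm hθ)).trans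
    (ringKrullDim_multiRees_quotient_le hd hd0 he K)

end ReesDimension

/-! ### Numbers of generators via the special fibre. -/

section SpecialFibre

open Finsupp MvPolynomial

variable {R : Type*} [CommRing R]

variable {κ : Type*} [Fintype κ] {K : κ → Ideal R}

/-- The inclusion of a homogeneous component into the Rees algebra. -/
noncomputable def multiReesMonomial (K : κ → Ideal R) (a : κ →₀ ℕ) :
    idealPow K a →ₗ[R] multiRees K :=
  ((monomial a).comp (idealPow K a).subtype).codRestrict (Subalgebra.toSubmodule (multiRees K))
    fun c => monomial_mem_multiRees c.2

/-- The projection of the Rees algebra onto a homogeneous component. -/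
noncomputable def multiReesCoeff (K : κ → Ideal R) (a : κ →₀ ℕ) :
    multiRees K →ₗ[R] idealPow K a :=
  ((lcoeff R a).comp (multiRees K).val.toLinearMap).codRestrict (idealPow K a) fun f => f.2 a

theorem multiReesCoeff_monomial_same (a : κ →₀ ℕ) (c : idealPow K a) :
    multiReesCoeff K a (multiReesMonomial K a c) = c := by
  classical
  refine Subtype.ext ?_
  change coeff a (monomial a c.1) = c.1
  rw [coeff_monomial, if_pos rfl]

theorem multiReesCoeff_monomial_of_ne {a b : κ →₀ ℕ} (h : a ≠ b) (c : idealPow K a) :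
    multiReesCoeff K b (multiReesMonomial K a c) = 0 := by
  classical
  refine Subtype.ext ?_
  change coeff b (monomial a c.1) = 0
  rw [coeff_monomial, if_neg h]

variable {k F : Type*} [Field k] [Algebra R k] [CommRing F] [Algebra k F] [Algebra R F]
  [IsScalarTower R k F]

/-- The elements of `idealPow K a` sent into V^|a| form a multiplicative family of ideals, so it
suffices to check unit vectors. -/
theorem map_multiReesMonomial_mem_pow (φ : multiRees K →ₐ[R] F) {V : Submodule k F}
    (hV : ∀ k (c : idealPow K (single k 1)), φ (multiReesMonomial K _ c) ∈ V)
    (a : κ →₀ ℕ) (c : idealPow K a) : φ (multiReesMonomial K a c) ∈ V ^ a.degree := by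
  set M : (κ →₀ ℕ) → Ideal R := fun a =>
    (((V ^ a.degree).restrictScalars R).comap
      (φ.toLinearMap.comp (multiReesMonomial K a))).map (idealPow K a).subtype with hM
  have hmem : ∀ a (x : R), x ∈ M a ↔ ∃ h : x ∈ idealPow K a,
      φ (multiReesMonomial K a ⟨x, h⟩) ∈ V ^ a.degree := by
    intro a x
    constructor
    · rintro ⟨y, hy, rfl⟩
      exact ⟨y.2, hy⟩
    · rintro ⟨h, hx⟩
      exact ⟨⟨x, h⟩, hx, rfl⟩
  have key : ∀ a, idealPow K a ≤ M a := by
    refine idealPow_le_of_single_le ?_ ?_ ?_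
    · rw [Ideal.eq_top_iff_one, hmem]
      refine ⟨by rw [idealPow_zero]; trivial, ?_⟩
      rw [map_zero, pow_zero, show multiReesMonomial K 0 ⟨1, _⟩ = 1 from rfl, map_one]
      exact Submodule.one_le.1 le_rfl
    · intro a b
      rw [Ideal.mul_le]
      intro x hx y hy
      rw [hmem] at hx hy ⊢
      obtain ⟨hx, hx'⟩ := hx
      obtain ⟨hy, hy'⟩ := hy
      refine ⟨by rw [idealPow_add]; exact Ideal.mul_mem_mul hx hy, ?_⟩
      have : multiReesMonomial K (a + b)
          ⟨x * y, by rw [idealPow_add]; exact Ideal.mul_mem_mul hx hy⟩ =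
          multiReesMonomial K a ⟨x, hx⟩ * multiReesMonomial K b ⟨y, hy⟩ :=
        Subtype.ext (monomial_mul (R := R) (s := a) (s' := b) (a := x) (b := y)).symm
      rw [this, map_mul, map_add, pow_add]
      exact Submodule.mul_mem_mul hx' hy'
    · intro j x hx
      have hx' : x ∈ idealPow K (single j 1) := by rwa [idealPow_single]
      rw [hmem]
      refine ⟨hx', ?_⟩
      rw [degree_single, pow_one]
      exact hV j ⟨x, hx'⟩
  exact ((hmem a c.1).1 (key a c.2)).2

/-- The kernel condition makes E a quotient of `X.comap φ` modulo ker φ, which embeds in X. -/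
theorem length_le_length_of_ker_le {M N E : Type*} [AddCommGroup M] [Module R M] [AddCommGroup N]
    [Module R N] [AddCommGroup E] [Module R E] {φ : M →ₗ[R] N} {Φ : M →ₗ[R] E}
    (hker : LinearMap.ker φ ≤ LinearMap.ker Φ) {X : Submodule R N}
    (hsurj : (X.comap φ).map Φ = ⊤) : Module.length R E ≤ Module.length R X := by
  set Y : Submodule R M := X.comap φ with hY
  have hYX : ∀ f ∈ Y, φ f ∈ X := fun f hf => hf
  have hker' : LinearMap.ker (φ.restrict hYX) ≤ LinearMap.ker (Φ ∘ₗ Y.subtype) := by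
    intro f hf
    exact hker (congrArg Subtype.val hf)
  refine (Module.length_le_of_surjective (Submodule.liftQ _ (Φ ∘ₗ Y.subtype) hker') ?_).trans
    (Module.length_le_of_injective (Submodule.liftQ _ (φ.restrict hYX) le_rfl)
      (LinearMap.ker_eq_bot.1 (Submodule.ker_liftQ_eq_bot _ _ _ le_rfl)))
  rw [← LinearMap.range_eq_top, Submodule.range_liftQ, LinearMap.range_comp,
    Submodule.range_subtype, hsurj]

variable [IsLocalRing R]

theorem spanFinrank_eq_length {M : Type*} [AddCommGroup M] [Module R M] (N : Submodule R M)
    (hN : N.FG) : (N.spanFinrank : ℕ∞) =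
      Module.length R (N ⧸ IsLocalRing.maximalIdeal R • (⊤ : Submodule R N)) := by
  let := Ideal.Quotient.field (IsLocalRing.maximalIdeal R)
  have : Module.Finite R N := Module.Finite.iff_fg.2 hN
  have hfin : Module.Finite (R ⧸ IsLocalRing.maximalIdeal R)
      (N ⧸ IsLocalRing.maximalIdeal R • (⊤ : Submodule R N)) :=
    Module.Finite.of_restrictScalars_finite R _ _
  have h := Module.length_eq_of_surjective (R := R ⧸ IsLocalRing.maximalIdeal R) (S := R)
    (M := N ⧸ IsLocalRing.maximalIdeal R • (⊤ : Submodule R N)) Ideal.Quotient.mk_surjective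
  rw [IsLocalRing.spanFinrank_eq_finrank_quotient N hN, h]
  exact (Module.length_eq_finrank _ _).symm

/-- The projection of the Rees algebra onto the special fibres of finitely many homogeneous
components. -/
noncomputable def multiReesFibreCoeff (K : κ → Ideal R) (A : Finset (κ →₀ ℕ)) :
    multiRees K →ₗ[R] ((a : A) → (idealPow K a.1 ⧸
      IsLocalRing.maximalIdeal R • (⊤ : Submodule R (idealPow K a.1)))) :=
  LinearMap.pi fun a => (IsLocalRing.maximalIdeal R •
    (⊤ : Submodule R (idealPow K a.1))).mkQ ∘ₗ multiReesCoeff K a.1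

theorem multiReesFibreCoeff_apply (A : Finset (κ →₀ ℕ)) (f : multiRees K) (a : A) :
    multiReesFibreCoeff K A f a = (IsLocalRing.maximalIdeal R •
      (⊤ : Submodule R (idealPow K a.1))).mkQ (multiReesCoeff K a.1 f) := rfl

theorem multiReesFibreCoeff_eq_zero (A : Finset (κ →₀ ℕ)) {f : multiRees K}
    (hf : f ∈ (IsLocalRing.maximalIdeal R).map (algebraMap R (multiRees K))) :
    multiReesFibreCoeff K A f = 0 := by
  have hf' : f ∈ IsLocalRing.maximalIdeal R • (⊤ : Submodule R (multiRees K)) := by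
    rw [Ideal.smul_top_eq_map]
    exact hf
  have hle : IsLocalRing.maximalIdeal R • (⊤ : Submodule R (multiRees K)) ≤
      LinearMap.ker (multiReesFibreCoeff K A) := by
    refine Submodule.smul_le.2 fun x hx g _ => ?_
    rw [LinearMap.mem_ker]
    funext a
    rw [multiReesFibreCoeff_apply, map_smul, Submodule.mkQ_apply, Pi.zero_apply,
      Submodule.Quotient.mk_eq_zero]
    exact Submodule.smul_mem_smul hx trivial
  exact hle hf'

/-- Nakayama turns generator numbers into lengths of the fibres of the components. All these
components map into V^n, because 1 ∈ V gives V^|a| ⊆ V^n, and `multiReesFibreCoeff` separates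
distinct degrees. -/
theorem sum_spanFinrank_le_finrank [IsNoetherianRing R]
    (hk : Function.Surjective (algebraMap R k)) (φ : multiRees K →ₐ[R] F)
    (hφ : ∀ f, φ f = 0 → f ∈ (IsLocalRing.maximalIdeal R).map (algebraMap R (multiRees K)))
    {V : Submodule k F} (h1 : 1 ∈ V) (hVfg : V.FG)
    (hV : ∀ k (c : idealPow K (single k 1)), φ (multiReesMonomial K _ c) ∈ V)
    (n : ℕ) (A : Finset (κ →₀ ℕ)) (hA : ∀ a ∈ A, a.degree ≤ n) :
    ∑ a ∈ A, (idealPow K a).spanFinrank ≤ Module.finrank k (V ^ n : Submodule k F) := by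
  classical
  have hlen := length_le_length_of_ker_le (φ := φ.toLinearMap) (Φ := multiReesFibreCoeff K A)
    (X := (V ^ n).restrictScalars R)
    (fun f hf => multiReesFibreCoeff_eq_zero A (hφ f hf)) (by
      rw [eq_top_iff]
      rintro v -
      rw [← Finset.univ_sum_single v]
      refine Submodule.sum_mem _ fun a _ => ?_
      obtain ⟨c, hc⟩ := Submodule.mkQ_surjective _ (v a)
      refine ⟨multiReesMonomial K a.1 c, ?_, ?_⟩
      · have h2 := map_multiReesMonomial_mem_pow φ hV a.1 c
        exact pow_le_pow_right' (Submodule.one_le.2 h1) (hA a.1 a.2) h2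
      · funext b
        rw [multiReesFibreCoeff_apply]
        by_cases hab : a = b
        · subst hab
          rw [multiReesCoeff_monomial_same, Pi.single_eq_same, hc]
        · rw [multiReesCoeff_monomial_of_ne (fun h => hab (Subtype.ext h)), map_zero,
            Pi.single_eq_of_ne (Ne.symm hab)])
  have hXlen : Module.length R ((V ^ n).restrictScalars R : Submodule R F) =
      Module.finrank k (V ^ n : Submodule k F) := by
    have : Module.Finite k (V ^ n : Submodule k F) := Module.Finite.iff_fg.2 (hVfg.pow n)
    rw [← Module.length_eq_finrank]
    exact Module.length_eq_of_surjective (R := k) (S := R) (M := (V ^ n : Submodule k F)) hk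
  rw [hXlen, Module.length_pi_of_fintype,
    Finset.sum_congr rfl fun (a : A) _ =>
      (spanFinrank_eq_length (idealPow K a.1) (IsNoetherian.noetherian _)).symm,
    Finset.sum_coe_sort A fun a => ((idealPow K a).spanFinrank : ℕ∞)] at hlen
  exact_mod_cast hlen

theorem exists_sum_spanFinrank_le_of_surjective [IsNoetherianRing R] {e : ℕ}
    (hk : Function.Surjective (algebraMap R k)) (φ : multiRees K →ₐ[R] F)
    (hφs : Function.Surjective φ)
    (hφ : ∀ f, φ f = 0 → f ∈ (IsLocalRing.maximalIdeal R).map (algebraMap R (multiRees K)))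
    (he : ringKrullDim F ≤ e) :
    ∃ C : ℕ, ∀ (n : ℕ) (A : Finset (κ →₀ ℕ)), (∀ a ∈ A, a.degree ≤ n) →
      ∑ a ∈ A, (idealPow K a).spanFinrank ≤ C * (n + 1) ^ e := by
  classical
  have hfin : Algebra.FiniteType R (multiRees K) :=
    (Subalgebra.fg_iff_finiteType _).1 (multiRees_fg K)
  have hfin' : Algebra.FiniteType R F := hfin.of_surjective φ hφs
  have hfin'' : Algebra.FiniteType k F := Algebra.FiniteType.of_restrictScalars_finiteType R _ _
  choose s hs using fun a => IsNoetherian.noetherian (⊤ : Submodule R (idealPow K a))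
  -- V is spanned by 1 and the images of generators of the degree-one components.
  set t : Finset F := insert 1 (Finset.univ.biUnion fun j : κ =>
    (s (single j 1)).image fun c => φ (multiReesMonomial K _ c)) with ht
  obtain ⟨C, hC⟩ := exists_finrank_pow_le (k := k) he (V := Submodule.span k (t : Set F)) ⟨t, rfl⟩
  refine ⟨C, fun n A hA => le_trans ?_ (hC n)⟩
  refine sum_spanFinrank_le_finrank hk φ hφ ?_ ⟨t, rfl⟩ ?_ n A hA
  · exact Submodule.subset_span (Finset.mem_insert_self _ _)
  · intro j c
    have hc : c ∈ Submodule.span R (s (single j 1) : Set (idealPow K (single j 1))) := by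
      rw [hs]; trivial
    have hle : Submodule.span R (s (single j 1) : Set (idealPow K (single j 1))) ≤
        ((Submodule.span k (t : Set F)).restrictScalars R).comap
          (φ.toLinearMap ∘ₗ multiReesMonomial K (single j 1)) := by
      refine Submodule.span_le.2 fun c hc => Submodule.subset_span (Finset.mem_insert_of_mem ?_)
      exact Finset.mem_biUnion.2 ⟨j, Finset.mem_univ j, Finset.mem_image.2 ⟨c, hc, rfl⟩⟩
    exact hle hc

theorem exists_sum_spanFinrank_le_of_ker_eq [IsNoetherianRing R] {F : Type*} [CommRing F]
    [Algebra R F] {e : ℕ} (φ : multiRees K →ₐ[R] F) (hφs : Function.Surjective φ)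
    (hφ : ∀ f, φ f = 0 ↔ f ∈ (IsLocalRing.maximalIdeal R).map (algebraMap R (multiRees K)))
    (he : ringKrullDim F ≤ e) :
    ∃ C : ℕ, ∀ (n : ℕ) (A : Finset (κ →₀ ℕ)), (∀ a ∈ A, a.degree ≤ n) →
      ∑ a ∈ A, (idealPow K a).spanFinrank ≤ C * (n + 1) ^ e := by
  have h0 : ∀ x ∈ IsLocalRing.maximalIdeal R, algebraMap R F x = 0 := fun x hx => by
    rw [← φ.commutes]
    exact (hφ _).2 (Ideal.mem_map_of_mem _ hx)
  let : Algebra (IsLocalRing.ResidueField R) F :=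
    (Ideal.Quotient.lift (IsLocalRing.maximalIdeal R) (algebraMap R F) h0).toAlgebra
  have : IsScalarTower R (IsLocalRing.ResidueField R) F :=
    IsScalarTower.of_algebraMap_eq fun x => rfl
  exact exists_sum_spanFinrank_le_of_surjective (k := IsLocalRing.ResidueField R)
    IsLocalRing.residue_surjective φ hφs (fun f => (hφ f).1) he

theorem exists_algHom_surjective_eq_zero_iff.{u, v} (R : Type u) {S : Type v} [CommRing R]
    [CommRing S] [Algebra R S] (𝔫 : Ideal S) :
    ∃ (F : Type v) (_ : CommRing F) (_ : Algebra R F) (φ : S →ₐ[R] F),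
      Function.Surjective φ ∧ ∀ f, φ f = 0 ↔ f ∈ 𝔫 :=
  ⟨S ⧸ 𝔫, inferInstance, inferInstance, Ideal.Quotient.mkₐ R 𝔫, Ideal.Quotient.mkₐ_surjective R 𝔫,
    fun _ => Ideal.Quotient.eq_zero_iff_mem⟩

/-- The numbers of generators of the products of powers of `m` ideals in a local ring of dimension
`d > 0` grow, cumulatively, at most like a polynomial of degree `d + m - 1`. -/
theorem exists_sum_spanFinrank_le [IsNoetherianRing R] {d e : ℕ}
    (hd : ringKrullDim R = d) (hd0 : d ≠ 0) (he : d + Fintype.card κ = e + 1) (K : κ → Ideal R) :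
    ∃ C : ℕ, ∀ (n : ℕ) (A : Finset (κ →₀ ℕ)), (∀ a ∈ A, a.degree ≤ n) →
      ∑ a ∈ A, (idealPow K a).spanFinrank ≤ C * (n + 1) ^ e := by
  obtain ⟨F, _, _, φ, hφs, hφ⟩ := exists_algHom_surjective_eq_zero_iff R
    ((IsLocalRing.maximalIdeal R).map (algebraMap R (multiRees K)))
  exact exists_sum_spanFinrank_le_of_ker_eq φ hφs hφ
    (ringKrullDim_le_of_multiRees_surjective hd hd0 he φ.toRingHom hφs fun f hf => (hφ f).2 hf)

end SpecialFibre

/-! ### The degree bound along rays. -/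

section DegreeBound

open Finsupp

variable {R : Type*} [CommRing R]

theorem toNat_quotLength_mul_le {I J : Ideal R} (h : quotLength J I < ⊤) {c : Ideal R}
    (hc : c.FG) :
    (quotLength (c * J) (c * I)).toNat ≤ c.spanFinrank * (quotLength J I).toNat := by
  obtain ⟨s, hs, hsc⟩ := Submodule.FG.exists_span_finset_card_eq_spanFinrank hc
  have h1 := quotLength_mul_le (J := J) (I := I) s
  rw [show Ideal.span (s : Set R) = c from hsc, hs] at h1
  rw [← ENat.natCast_toNat h.ne] at h1
  have h2 := ENat.toNat_le_toNat h1 (by exact_mod_cast ENat.natCast_ne_top _)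
  rwa [← Nat.cast_mul, ENat.toNat_natCast] at h2

/-- The multi-index with entries `a` and `b`. -/
noncomputable def pairIndex (a b : ℕ) : Fin 2 →₀ ℕ := single 0 a + single 1 b

theorem pairIndex_inj {a b a' b' : ℕ} (h : pairIndex a b = pairIndex a' b') : a = a' ∧ b = b' := by
  refine ⟨?_, ?_⟩
  · simpa [pairIndex] using DFunLike.congr_fun h 0
  · simpa [pairIndex] using DFunLike.congr_fun h 1

theorem degree_pairIndex (a b : ℕ) : (pairIndex a b).degree = a + b := by
  simp [pairIndex]

theorem idealPow_pairIndex (J I : Ideal R) (a b : ℕ) :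
    idealPow ![J, I] (pairIndex a b) = I ^ b * J ^ a := by
  simp [idealPow, pairIndex, Fin.prod_univ_two, mul_comm]

theorem toNat_quotLength_pow_le [IsNoetherianRing R] {I J : Ideal R} (hIJ : I ≤ J)
    (h : quotLength J I < ⊤) (m : ℕ) :
    (quotLength (J ^ (m + 1)) (I ^ (m + 1))).toNat ≤
      (∑ t ∈ Finset.range (m + 1), (idealPow ![J, I] (pairIndex (m - t) t)).spanFinrank) *
        (quotLength J I).toNat := by
  have h1 := quotLength_pow_mul hIJ ⊤ m
  simp only [Ideal.mul_top] at h1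
  rw [h1, Finset.sum_mul]
  have hfin : ∀ t ∈ Finset.range (m + 1),
      quotLength (I ^ t * J ^ (m - t) * J) (I ^ t * J ^ (m - t) * I) ≠ ⊤ := fun t _ =>
    (quotLength_mul_lt_top _ h).ne
  rw [Finset.sum_congr rfl fun t ht => (ENat.natCast_toNat (hfin t ht)).symm, ← Nat.cast_sum,
    ENat.toNat_natCast]
  refine Finset.sum_le_sum fun t _ => ?_
  rw [idealPow_pairIndex]
  exact toNat_quotLength_mul_le h (IsNoetherian.noetherian _)

theorem exists_sum_quotLength_pow_le [IsLocalRing R] [IsNoetherianRing R] {d : ℕ}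
    (hd : ringKrullDim R = d) {I J : Ideal R} (hIJ : I ≤ J) (h : quotLength J I < ⊤) :
    ∃ C : ℕ, ∀ M : ℕ, ∑ m ∈ Finset.range M, (quotLength (J ^ (m + 1)) (I ^ (m + 1))).toNat ≤
      C * (M + 1) ^ (d + 1) := by
  classical
  rcases eq_or_ne d 0 with rfl | hd0
  -- The special fibre estimate needs d > 0; for d = 0 all lengths are bounded by that of the
  -- Artinian ring R.
  · have : Ring.KrullDimLE 0 R := (Ring.krullDimLE_iff).2 (by rw [hd])
    have : IsArtinianRing R := isArtinianRing_iff_isNoetherianRing_krullDimLE_zero.2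
      ⟨inferInstance, inferInstance⟩
    have hfl : Module.length R R ≠ ⊤ := Module.length_ne_top
    refine ⟨(Module.length R R).toNat, fun M => ?_⟩
    refine (Finset.sum_le_card_nsmul _ _ (Module.length R R).toNat fun m _ =>
      ENat.toNat_le_toNat (quotLength_le_length _ _) hfl).trans ?_
    rw [Finset.card_range, smul_eq_mul, mul_comm, zero_add, pow_one]
    exact Nat.mul_le_mul_left _ (Nat.le_succ M)
  · obtain ⟨C, hC⟩ := exists_sum_spanFinrank_le hd hd0
      (show d + Fintype.card (Fin 2) = (d + 1) + 1 by simp) ![J, I]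
    refine ⟨C * (quotLength J I).toNat, fun M => ?_⟩
    refine (Finset.sum_le_sum fun m _ => toNat_quotLength_pow_le hIJ h m).trans ?_
    rw [← Finset.sum_mul, mul_right_comm, Finset.sum_sigma']
    refine Nat.mul_le_mul_right _ ?_
    -- The pairs (m - t, t) with t ≤ m < M are distinct and of degree m < M, so the double sum is a
    -- single sum of generator numbers, bounded by the special fibre estimate for two ideals with e
    -- = d + 1.
    have hinj : Set.InjOn (fun p : (_ : ℕ) × ℕ => pairIndex (p.1 - p.2) p.2)
        ((Finset.range M).sigma fun m => Finset.range (m + 1) : Finset ((_ : ℕ) × ℕ)) := by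
      rintro ⟨m, t⟩ hm ⟨m', t'⟩ hm' he
      simp only [Finset.coe_sigma, Set.mem_sigma_iff, Finset.mem_coe, Finset.mem_range] at hm hm'
      obtain ⟨h1, h2⟩ := pairIndex_inj he
      dsimp only at h1 h2
      obtain rfl : t = t' := h2
      obtain rfl : m = m' := by omega
      rfl
    refine le_of_eq_of_le ?_ (hC M (((Finset.range M).sigma fun m => Finset.range (m + 1)).image
      fun p : (_ : ℕ) × ℕ => pairIndex (p.1 - p.2) p.2) ?_)
    · rw [Finset.sum_image hinj]
    · intro a ha
      obtain ⟨p, hp, rfl⟩ := Finset.mem_image.1 ha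
      rw [Finset.mem_sigma, Finset.mem_range, Finset.mem_range] at hp
      rw [degree_pairIndex]
      omega

/-- A rational polynomial that is non-negative at large integers and whose partial sums grow at
most like the `(d + 1)`-st power has degree at most `d`. -/
theorem natDegree_le_of_sum_le {p : Polynomial ℚ} {d N : ℕ} {C : ℚ} (f : ℕ → ℕ)
    (hf : ∀ m, N ≤ m → p.eval ((m : ℚ) + 1) = f m)
    (hsum : ∀ M : ℕ, ((∑ m ∈ Finset.range M, f m : ℕ) : ℚ) ≤ C * ((M : ℚ) + 1) ^ (d + 1)) :
    p.natDegree ≤ d := by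
  by_contra! hlt
  have hdeg : (Polynomial.X ^ (d + 1) : Polynomial ℚ).degree ≤ p.degree := by
    rw [Polynomial.degree_X_pow]
    rw [Polynomial.degree_eq_natDegree fun h0 => by simp [h0] at hlt]
    exact_mod_cast hlt
  obtain ⟨c, hc0, hc⟩ := (Polynomial.isBigO_atTop_of_degree_le _ _ hdeg).exists_pos
  rw [Asymptotics.isBigOWith_iff, Filter.eventually_atTop] at hc
  obtain ⟨x, hx⟩ := hc
  obtain ⟨M₀, hM₀⟩ := exists_nat_ge x
  -- If deg p ≥ d + 1, each of the M terms on [M, 2M) is at least M^(d+1)/c, while the partial sum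
  -- is at most C(2M+1)^(d+1) ≤ C(3M)^(d+1). This forces M ≤ c C 3^(d+1).
  obtain ⟨M₁, hM₁⟩ := exists_nat_gt (c * (C * 3 ^ (d + 1)))
  set M := M₀ + N + M₁ + 1 with hM
  have hM0 : (0 : ℝ) < M := by positivity
  have hterm : ∀ m ∈ Finset.Ico M (2 * M), (M : ℝ) ^ (d + 1) ≤ c * f m := by
    intro m hm
    have hm' : M ≤ m := (Finset.mem_Ico.1 hm).1
    have hmx : (M₀ : ℚ) ≤ m := by exact_mod_cast (by omega : M₀ ≤ m)
    have h := hx ((m : ℚ) + 1) (by linarith)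
    rw [hf m (by omega), Polynomial.eval_pow, Polynomial.eval_X, ← Rat.norm_cast_real,
      ← Rat.norm_cast_real, Real.norm_of_nonneg (by positivity),
      Real.norm_of_nonneg (by positivity)] at h
    push_cast at h
    refine le_trans ?_ h
    have hmM : (M : ℝ) ≤ m := by exact_mod_cast hm'
    gcongr
    linarith
  have hsum' : ((∑ m ∈ Finset.range (2 * M), f m : ℕ) : ℝ) ≤
      C * (((2 * M : ℕ) : ℝ) + 1) ^ (d + 1) := by exact_mod_cast hsum (2 * M)
  have hC0 : (0 : ℝ) ≤ C := by
    have h := hsum 0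
    simp only [Finset.range_zero, Finset.sum_empty, Nat.cast_zero, zero_add, one_pow,
      mul_one] at h
    exact_mod_cast h
  have h1 : (M : ℝ) * (M : ℝ) ^ (d + 1) ≤ c * (C * 3 ^ (d + 1)) * (M : ℝ) ^ (d + 1) := by
    calc (M : ℝ) * (M : ℝ) ^ (d + 1) = ∑ m ∈ Finset.Ico M (2 * M), (M : ℝ) ^ (d + 1) := by
          rw [Finset.sum_const, Nat.card_Ico, nsmul_eq_mul, two_mul, Nat.add_sub_cancel]
      _ ≤ ∑ m ∈ Finset.Ico M (2 * M), c * f m := Finset.sum_le_sum hterm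
      _ ≤ ∑ m ∈ Finset.range (2 * M), c * f m := by
          refine Finset.sum_le_sum_of_subset_of_nonneg (fun m hm => ?_) fun m _ _ => by positivity
          exact Finset.mem_range.2 (Finset.mem_Ico.1 hm).2
      _ = c * ((∑ m ∈ Finset.range (2 * M), f m : ℕ) : ℝ) := by
          rw [← Finset.mul_sum, Nat.cast_sum]
      _ ≤ c * (C * (((2 * M : ℕ) : ℝ) + 1) ^ (d + 1)) := by gcongr
      _ ≤ c * (C * (3 * (M : ℝ)) ^ (d + 1)) := by
          have h1M : (1 : ℝ) ≤ M := by exact_mod_cast (by omega : 1 ≤ M)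
          gcongr
          push_cast
          linarith
      _ = c * (C * 3 ^ (d + 1)) * (M : ℝ) ^ (d + 1) := by
          rw [mul_pow]
          ring
  have h2 := le_of_mul_le_mul_right h1 (by positivity)
  have h3 : (M₁ : ℝ) ≤ M := by exact_mod_cast (by omega : M₁ ≤ M)
  linarith

theorem coeff_aeval_line {σ : Type*} (F : MvPolynomial σ ℚ) (a : σ → ℚ) (k : ℕ) :
    (MvPolynomial.aeval (fun i => Polynomial.C (0 : ℚ) + Polynomial.C (a i) * Polynomial.X)
      F).coeff k = MvPolynomial.eval a (MvPolynomial.homogeneousComponent k F) := by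
  induction F using MvPolynomial.induction_on' with
  | monomial s c =>
    rw [MvPolynomial.homogeneousComponent_of_mem
      (MvPolynomial.isHomogeneous_monomial (n := s.degree) c rfl)]
    have h : MvPolynomial.aeval (fun i => Polynomial.C (0 : ℚ) + Polynomial.C (a i) *
        Polynomial.X) (MvPolynomial.monomial s c) =
        Polynomial.C (MvPolynomial.eval a (MvPolynomial.monomial s c)) *
          Polynomial.X ^ s.degree := by
      rw [MvPolynomial.aeval_monomial, MvPolynomial.eval_monomial, map_mul, mul_assoc]
      simp only [map_zero, zero_add, mul_pow, Finsupp.prod, Finset.prod_mul_distrib,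
        Finset.prod_pow_eq_pow_sum, map_prod, map_pow]
      rfl
    rw [h, Polynomial.coeff_C_mul_X_pow]
    split_ifs <;> simp_all
  | add p q hp hq => simp only [map_add, Polynomial.coeff_add, hp, hq]

/-- For k > d the component F_k vanishes at all points with positive integer coordinates, a product
of infinite sets, so F_k = 0. -/
theorem totalDegree_le_of_natDegree_line_le {σ : Type*} {F : MvPolynomial σ ℚ} {d : ℕ}
    (h : ∀ a : σ → ℕ, (∀ i, 0 < a i) →
      (MvPolynomial.aeval (fun i => Polynomial.C (0 : ℚ) + Polynomial.C (a i : ℚ) * Polynomial.X)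
        F).natDegree ≤ d) : F.totalDegree ≤ d := by
  classical
  have hzero : ∀ k, d < k → MvPolynomial.homogeneousComponent k F = 0 := by
    intro k hk
    have hinf : (Set.range fun n : ℕ => ((n + 1 : ℕ) : ℚ)).Infinite :=
      Set.infinite_range_of_injective fun m n hmn => by
        have : m + 1 = n + 1 := by exact_mod_cast hmn
        omega
    refine MvPolynomial.funext_set (fun _ => Set.range fun n : ℕ => ((n + 1 : ℕ) : ℚ))
      (fun _ => hinf) fun x hx => ?_
    choose a ha using fun i => hx i trivial
    obtain rfl : (fun i => ((a i + 1 : ℕ) : ℚ)) = x := funext ha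
    rw [← coeff_aeval_line, map_zero (MvPolynomial.eval _)]
    exact Polynomial.coeff_eq_zero_of_natDegree_lt
      ((h (fun i => a i + 1) fun i => Nat.succ_pos _).trans_lt hk)
  refine Finset.sup_le fun s hs => ?_
  change s.degree ≤ d
  by_contra! hlt
  refine MvPolynomial.mem_support_iff.1 hs ?_
  have h1 := MvPolynomial.coeff_homogeneousComponent s.degree F s
  rw [if_pos rfl, hzero s.degree hlt] at h1
  rw [← h1, MvPolynomial.coeff_zero]

theorem multiPower_smul {r : ℕ} (I : Fin r → Ideal R) (t : ℕ) (a : Fin r → ℕ) :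
    multiPower I (t • a) = multiPower I a ^ t := by
  simp only [multiPower, Pi.smul_apply, smul_eq_mul]
  rw [← Finset.prod_pow]
  exact Finset.prod_congr rfl fun i _ => by rw [← pow_mul, mul_comm]

theorem multiPower_mono {r : ℕ} {I J : Fin r → Ideal R} (h : ∀ i, I i ≤ J i) (n : Fin r → ℕ) :
    multiPower I n ≤ multiPower J n :=
  Finset.prod_le_prod' fun i _ => pow_le_pow_left' (h i) _

end DegreeBound

theorem theorem5p3 {R : Type*} [CommRing R] [IsLocalRing R] [IsNoetherianRing R]
    (d : ℕ) (hd : ringKrullDim R = d) (r : ℕ) (I J : Fin r → Ideal R)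
    (hIJ : ∀ i, I i ≤ J i) (hlen : ∀ i, quotLength (J i) (I i) < ⊤) :
    ∃ F : MvPolynomial (Fin r) ℚ, IsNumericalPolynomial F ∧ F.totalDegree ≤ d ∧
      ∃ N : ℕ, ∀ n : Fin r → ℕ, (∀ i, N ≤ n i) →
        ∃ l : ℕ, quotLength (multiPower J n) (multiPower I n) = l ∧
          MvPolynomial.eval (fun i => (n i : ℚ)) F = l := by
  obtain ⟨F, N, hF⟩ := eventuallyPolynomial_quotLength_multiPower hIJ hlen
  refine ⟨F, isNumericalPolynomial_of_eventually (N := N) fun n hn =>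
    ⟨((quotLength (multiPower J n) (multiPower I n)).toNat : ℤ), by rw [hF n hn]; norm_cast⟩,
    ?_, N, fun n hn => ⟨(quotLength (multiPower J n) (multiPower I n)).toNat,
      (ENat.natCast_toNat (quotLength_multiPower_lt_top hIJ hlen n).ne).symm, hF n hn⟩⟩
  -- On the ray through a, the ideals are the powers of `multiPower J a` and `multiPower I a`, whose
  -- quotient again has finite length. Positivity of a makes (m+1)a ≥ N for m ≥ N.
  refine totalDegree_le_of_natDegree_line_le fun a ha => ?_
  obtain ⟨C, hC⟩ := exists_sum_quotLength_pow_le hd (multiPower_mono hIJ a)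
    (quotLength_multiPower_lt_top hIJ hlen a)
  refine natDegree_le_of_sum_le (N := N) (C := C) (fun m => (quotLength (multiPower J a ^ (m + 1))
    (multiPower I a ^ (m + 1))).toNat) (fun m hm => ?_) (fun M => by exact_mod_cast hC M)
  rw [MvPolynomial.eval_lineMap]
  have h := hF ((m + 1) • a) fun i => by
    rw [Pi.smul_apply, smul_eq_mul]
    nlinarith [ha i]
  dsimp only at h
  rw [multiPower_smul, multiPower_smul] at h
  rw [← h]
  congr 2
  funext i
  simp [mul_comm]
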